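/- Fix pairwise disjoint countably infinite sets of datatype variables $\alpha,\beta,\dots$, of type variables $X,Y,\dots$ and of constants $c,d,\dots$; $V,W$ range over variables of both sorts and $a$ over variables and constants. The $\mu$-datatypes $D$ and the $\mu$-types $A$ are given by $$D ::= \alpha \mid c \mid D\mathbin{@}A \mid D\oplus D \mid \mu\alpha.D, \qquad A ::= X \mid D \mid A\supset A \mid A\oplus A \mid \mu X.A,$$ up to renaming of bound variables. Only contractive expressions are considered: in every subexpression $\mu V.A$, the variable $V$ occurs in $A$ only under $\supset$ or $@$, if at all. Let $\mathcal T$ be the set of contractive $\mu$-types. All rules below relate elements of $\mathcal T$, the left arguments $D,D'$ of $@$ being datatypes. Write $A\{B/V\}$ for capture-avoiding substitution. **Type equivalence.** $\simeq_\mu$ is the least congruence with respect to $@$, $\supset$, $\oplus$ and $\mu V.(\cdot)$ on $\mathcal T$ (in particular an equivalence relation) such that $A\oplus A\simeq_\mu A$, $A\oplus B\simeq_\mu B\oplus A$, $A\oplus(B\oplus C)\simeq_\mu(A\oplus B)\oplus C$, $\mu V.A\simeq_\mu A\{\mu V.A/V\}$, and: if $A\simeq_\mu B\{A/V\}$ and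 $\mu V.B$ is contractive (with $A$ a datatype when $V$ is a datatype variable), then $A\simeq_\mu\mu V.B$. **Strong subtyping.** For a set $\Sigma$ of assumptions $V\preceq_\mu W$ between variables, $\Sigma\vdash A\preceq_\mu B$ is defined inductively by the rules: * $\Sigma\vdash A\preceq_\mu A$; $\Sigma,V\preceq_\mu W\vdash V\preceq_\mu W$; if $A\simeq_\mu B$ then $\Sigma\vdash A\preceq_\mu B$; transitivity for fixed $\Sigma$; * if $\Sigma\vdash D\preceq_\mu D'$ and $\Sigma\vdash A\preceq_\mu A'$ then $\Sigma\vdash D\mathbin{@}A\preceq_\mu D'\mathbin{@}A'$; * if $\Sigma\vdash A\preceq_\mu A'$ and $\Sigma\vdash B\preceq_\mu B'$ then $\Sigma\vdash A'\supset B\preceq_\mu A\supset B'$; * if $\Sigma\vdash A\preceq_\mu C$ and $\Sigma\vdash B\preceq_\mu C$ then $\Sigma\vdash A\oplus B\preceq_\mu C$; if $\Sigma\vdash A\preceq_\mu B$ or $\Sigma\vdash A\preceq_\mu C$ then $\Sigma\vdash A\preceq_\mu B\oplus C$; * if $\Sigma,V\preceq_\mu W\vdash A\preceq_\mu B$, where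 $W$ is not free in $A$, $V$ is not free in $B$, and neither $V$ nor $W$ occurs in $\Sigma$, then $\Sigma\vdash\mu V.A\preceq_\mu\mu W.B$. Write $A\preceq_\mu B$ for $\emptyset\vdash A\preceq_\mu B$. **Coinductive subtyping.** $\preceq_{\vec\mu}$ is the greatest relation on $\mathcal T$ such that every pair in it is the conclusion of one of the following rules with all premises in the relation. Here $\bigoplus_{i\in 1..n}A_i$ is an iterated union, with any association of $\oplus$, and $A\neq\mu$, $A\neq\oplus$ mean that the root symbol of $A$ is not $\mu$, respectively not $\oplus$. * $a\preceq_{\vec\mu}a$; * $D\mathbin{@}A\preceq_{\vec\mu}D'\mathbin{@}A'$ from $D\preceq_{\vec\mu}D'$ and $A\preceq_{\vec\mu}A'$; * $A\supset B\preceq_{\vec\mu}A'\supset B'$ from $A'\preceq_{\vec\mu}A$ and $B\preceq_{\vec\mu}B'$; * $\mu V.A\preceq_{\vec\mu}B$ from $A\{\mu V.A/V\}\preceq_{\vec\mu}B$; * $A\preceq_{\vec\mu}\mu W.B$ from $A\preceq_{\vec\mu}B\{\mu W.B/W\}$, if $A\neq\mu$; * $\bigoplus_{i\in 1..n}A_i\preceq_{\vec\mu}B$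 from $A_i\preceq_{\vec\mu}B$ for all $i$, if $n>1$, $B\neq\mu$ and all $A_i\neq\oplus$; * $A\preceq_{\vec\mu}\bigoplus_{j\in 1..m}B_j$ from $A\preceq_{\vec\mu}B_k$ for some $k\in 1..m$, if $m>1$, $A\neq\mu,\oplus$ and all $B_j\neq\oplus$. **Proposition.** For all contractive $\mu$-types $A,B$: $A\preceq_{\vec\mu}B$ if and only if $A\preceq_\mu B$. -/

import Mathlib

namespace MuTypes

/-- The two sorts of type expressions: datatypes and arbitrary types. -/
inductive Kind where
  | data
  | typ

/-- Variables: the disjoint union of the datatype variables `DV` and the type variables `TV`. -/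
abbrev Var (DV TV : Type*) := DV ⊕ TV

/-- The sort of a variable. -/
def Var.kind {DV TV : Type*} : Var DV TV → Kind
  | .inl _ => .data
  | .inr _ => .typ

/-- Raw type expressions up to renaming of bound variables, in locally nameless form: free
variables carry their names, bound variables are de Bruijn indices. The expression `μV.A'`, with
`V` of sort `k`, is `mu k A`, where `A` is `A'` with the free occurrences of `V` replaced by the
index of the new binder. -/
inductive PreType (DV TV C : Type*) where
  | bvar (i : ℕ)
  | var (V : Var DV TV)
  | const (c : C)
  | comp (D A : PreType DV TV C)
  | arrow (A B : PreType DV TV C)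
  | union (A B : PreType DV TV C)
  | mu (k : Kind) (A : PreType DV TV C)

namespace PreType

variable {DV TV C : Type*}

/-- `instAt u i A` replaces the index that refers to the `i`-th binder outside `A` by `u`. It is
only used with a `u` that has no dangling index, so nothing is captured. -/
def instAt (u : PreType DV TV C) : ℕ → PreType DV TV C → PreType DV TV C
  | i, bvar j => if j = i then u else bvar j
  | _, var V => var V
  | _, const c => const c
  | i, comp D A => comp (instAt u i D) (instAt u i A)
  | i, arrow A B => arrow (instAt u i A) (instAt u i B)
  | i, union A B => union (instAt u i A) (instAt u i B)
  | i, mu k A => mu k (instAt u (i + 1) A)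

/-- Substitution for the variable of the enclosing binder: if `mu k A` stands for `μV.A'`, then
`A.inst u` is `A'{u/V}`. In particular `A.inst (var V)` is the named body `A'` when `V` is not
free in `A`, and `A.inst (mu k A)` is the unfolding of `mu k A`. -/
def inst (A u : PreType DV TV C) : PreType DV TV C := instAt u 0 A

/-- The free variables. -/
def fv : PreType DV TV C → Set (Var DV TV)
  | bvar _ => ∅
  | var V => {V}
  | const _ => ∅
  | comp D A => D.fv ∪ A.fv
  | arrow A B => A.fv ∪ B.fv
  | union A B => A.fv ∪ B.fv
  | mu _ A => A.fv

/-- The variable bound by the `i`-th binder outside the expression occurs in it only under `⊃` or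
`@`, if at all. -/
def GuardedAt : ℕ → PreType DV TV C → Prop
  | i, bvar j => j ≠ i
  | _, var _ => True
  | _, const _ => True
  | _, comp _ _ => True
  | _, arrow _ _ => True
  | i, union A B => GuardedAt i A ∧ GuardedAt i B
  | i, mu _ A => GuardedAt (i + 1) A

/-- Every subexpression `μV.A` is contractive. -/
def Contractive : PreType DV TV C → Prop
  | bvar _ => True
  | var _ => True
  | const _ => True
  | comp D A => D.Contractive ∧ A.Contractive
  | arrow A B => A.Contractive ∧ B.Contractive
  | union A B => A.Contractive ∧ B.Contractive
  | mu _ A => GuardedAt 0 A ∧ A.Contractive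

/-- The grammar: `WellSorted Γ .data` are the datatypes `D ::= α | c | D @ A | D ⊕ D | μα.D`, and
`WellSorted Γ .typ` are the types `A ::= X | D | A ⊃ A | A ⊕ A | μX.A`. The list `Γ` holds the
sorts of the variables of the enclosing binders, innermost first. -/
inductive WellSorted : List Kind → Kind → PreType DV TV C → Prop
  | bvar {Γ : List Kind} {i : ℕ} {k : Kind} (h : Γ[i]? = some k) : WellSorted Γ k (bvar i)
  | var {Γ : List Kind} {k : Kind} (V : Var DV TV) (h : V.kind = k) : WellSorted Γ k (var V)
  | const {Γ : List Kind} (c : C) : WellSorted Γ .data (const c)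
  | comp {Γ : List Kind} {D A : PreType DV TV C} (hD : WellSorted Γ .data D)
      (hA : WellSorted Γ .typ A) : WellSorted Γ .data (comp D A)
  | arrow {Γ : List Kind} {A B : PreType DV TV C} (hA : WellSorted Γ .typ A)
      (hB : WellSorted Γ .typ B) : WellSorted Γ .typ (arrow A B)
  | union {Γ : List Kind} {k : Kind} {A B : PreType DV TV C} (hA : WellSorted Γ k A)
      (hB : WellSorted Γ k B) : WellSorted Γ k (union A B)
  | mu {Γ : List Kind} {k : Kind} {A : PreType DV TV C} (hA : WellSorted (k :: Γ) k A) :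
      WellSorted Γ k (mu k A)
  | ofData {Γ : List Kind} {A : PreType DV TV C} (hA : WellSorted Γ .data A) :
      WellSorted Γ .typ A

/-- Contractive expressions of sort `k`. -/
def IsOfKind (k : Kind) (A : PreType DV TV C) : Prop := WellSorted [] k A ∧ A.Contractive

/-- Contractive `μ`-datatypes. -/
def IsMuDatatype (A : PreType DV TV C) : Prop := IsOfKind .data A

/-- Contractive `μ`-types. -/
def IsMuType (A : PreType DV TV C) : Prop := IsOfKind .typ A

/-- Type equivalence of contractive `μ`-types. -/
inductive TyEq : PreType DV TV C → PreType DV TV C → Prop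
  | refl {A : PreType DV TV C} (hA : IsMuType A) : TyEq A A
  | trans {A B E : PreType DV TV C} (h₁ : TyEq A B) (h₂ : TyEq B E) : TyEq A E
  | symm {A B : PreType DV TV C} (h : TyEq A B) : TyEq B A
  | comp {D D' A A' : PreType DV TV C} (hD : IsMuDatatype D) (hD' : IsMuDatatype D')
      (h₁ : TyEq D D') (h₂ : TyEq A A') : TyEq (comp D A) (comp D' A')
  | arrow {A A' B B' : PreType DV TV C} (h₁ : TyEq A A') (h₂ : TyEq B B') :
      TyEq (arrow A B) (arrow A' B')
  | union_idem {A : PreType DV TV C} (hA : IsMuType A) : TyEq (union A A) A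
  | union_comm {A B : PreType DV TV C} (hA : IsMuType A) (hB : IsMuType B) :
      TyEq (union A B) (union B A)
  | union_assoc {A B E : PreType DV TV C} (hA : IsMuType A) (hB : IsMuType B)
      (hE : IsMuType E) : TyEq (union A (union B E)) (union (union A B) E)
  | union {A A' B B' : PreType DV TV C} (h₁ : TyEq A A') (h₂ : TyEq B B') :
      TyEq (union A B) (union A' B')
  | mu {k : Kind} {V : Var DV TV} {A B : PreType DV TV C} (hV : V.kind = k)
      (hA : IsMuType (mu k A)) (hB : IsMuType (mu k B)) (hVA : V ∉ A.fv) (hVB : V ∉ B.fv)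
      (h : TyEq (A.inst (var V)) (B.inst (var V))) : TyEq (mu k A) (mu k B)
  | fold {k : Kind} {A : PreType DV TV C} (hA : IsMuType (mu k A)) :
      TyEq (mu k A) (A.inst (mu k A))
  | contr {k : Kind} {A B : PreType DV TV C} (hA : IsOfKind k A) (hB : IsMuType (mu k B))
      (h : TyEq A (B.inst A)) : TyEq A (mu k B)

/-- `V` does not occur in the set `S` of assumptions. -/
def NotInCtx (V : Var DV TV) (S : Set (Var DV TV × Var DV TV)) : Prop :=
  ∀ p ∈ S, p.1 ≠ V ∧ p.2 ≠ V

/-- Strong subtyping of contractive `μ`-types under a set of assumptions `V ⪯ W` between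
variables. In the rule `mu`, `A.inst (var V)` and `B.inst (var W)` are the bodies of the two
recursive types with bound variables named `V` and `W`. -/
inductive StrongSub : Set (Var DV TV × Var DV TV) → PreType DV TV C → PreType DV TV C → Prop
  | refl {S : Set (Var DV TV × Var DV TV)} {A : PreType DV TV C} (hA : IsMuType A) :
      StrongSub S A A
  | hyp {S : Set (Var DV TV × Var DV TV)} {V W : Var DV TV} (h : (V, W) ∈ S) :
      StrongSub S (var V) (var W)
  | eq {S : Set (Var DV TV × Var DV TV)} {A B : PreType DV TV C} (h : TyEq A B) :
      StrongSub S A B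
  | trans {S : Set (Var DV TV × Var DV TV)} {A B E : PreType DV TV C}
      (h₁ : StrongSub S A B) (h₂ : StrongSub S B E) : StrongSub S A E
  | comp {S : Set (Var DV TV × Var DV TV)} {D D' A A' : PreType DV TV C}
      (hD : IsMuDatatype D) (hD' : IsMuDatatype D')
      (h₁ : StrongSub S D D') (h₂ : StrongSub S A A') : StrongSub S (comp D A) (comp D' A')
  | arrow {S : Set (Var DV TV × Var DV TV)} {A A' B B' : PreType DV TV C}
      (h₁ : StrongSub S A A') (h₂ : StrongSub S B B') : StrongSub S (arrow A' B) (arrow A B')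
  | union_l {S : Set (Var DV TV × Var DV TV)} {A B E : PreType DV TV C}
      (h₁ : StrongSub S A E) (h₂ : StrongSub S B E) : StrongSub S (union A B) E
  | union_r1 {S : Set (Var DV TV × Var DV TV)} {A B E : PreType DV TV C} (hE : IsMuType E)
      (h : StrongSub S A B) : StrongSub S A (union B E)
  | union_r2 {S : Set (Var DV TV × Var DV TV)} {A B E : PreType DV TV C} (hB : IsMuType B)
      (h : StrongSub S A E) : StrongSub S A (union B E)
  | mu {S : Set (Var DV TV × Var DV TV)} {k l : Kind} {V W : Var DV TV} {A B : PreType DV TV C}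
      (hV : V.kind = k) (hW : W.kind = l) (hA : IsMuType (mu k A)) (hB : IsMuType (mu l B))
      (hVA : V ∉ A.fv) (hWB : W ∉ B.fv) (hVS : NotInCtx V S) (hWS : NotInCtx W S)
      (hWA : W ∉ (A.inst (var V)).fv) (hVB : V ∉ (B.inst (var W)).fv)
      (h : StrongSub (insert (V, W) S) (A.inst (var V)) (B.inst (var W))) :
      StrongSub S (mu k A) (mu l B)

/-- The root symbol is `μ`. -/
def IsMu : PreType DV TV C → Prop
  | mu _ _ => True
  | _ => False

/-- The root symbol is `⊕`. -/
def IsUnion : PreType DV TV C → Prop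
  | union _ _ => True
  | _ => False

/-- The list `A₁, …, Aₙ` of types `Aᵢ ≠ ⊕` such that `A` is the maximal union of the `Aᵢ`,
irrespective of how unions are associated. -/
def summands : PreType DV TV C → List (PreType DV TV C)
  | union A B => A.summands ++ B.summands
  | bvar i => [bvar i]
  | var V => [var V]
  | const c => [const c]
  | comp D A => [comp D A]
  | arrow A B => [arrow A B]
  | mu k A => [mu k A]

/-- The generating function of the coinductive subtyping rules: `CoStep R A B` holds when some
rule with conclusion `A ⪯ B` has all its premises in `R`. -/
inductive CoStep (R : PreType DV TV C → PreType DV TV C → Prop) :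
    PreType DV TV C → PreType DV TV C → Prop
  | refl_var (V : Var DV TV) : CoStep R (var V) (var V)
  | refl_const (c : C) : CoStep R (const c) (const c)
  | comp {D D' A A' : PreType DV TV C} (h₁ : R D D') (h₂ : R A A') :
      CoStep R (comp D A) (comp D' A')
  | arrow {A A' B B' : PreType DV TV C} (h₁ : R A' A) (h₂ : R B B') :
      CoStep R (arrow A B) (arrow A' B')
  | mu_l {k : Kind} {A B : PreType DV TV C} (h : R (A.inst (mu k A)) B) : CoStep R (mu k A) B
  | mu_r {k : Kind} {A B : PreType DV TV C} (hA : ¬ A.IsMu) (h : R A (B.inst (mu k B))) :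
      CoStep R A (mu k B)
  | union_l {A B : PreType DV TV C} (hn : 1 < A.summands.length) (hB : ¬ B.IsMu)
      (h : ∀ A' ∈ A.summands, R A' B) : CoStep R A B
  | union_r {A B : PreType DV TV C} (hm : 1 < B.summands.length) (hA : ¬ A.IsMu)
      (hA' : ¬ A.IsUnion) (h : ∃ B' ∈ B.summands, R A B') : CoStep R A B

/-- Coinductive subtyping: the greatest fixed point of `CoStep` on pairs of contractive
`μ`-types, that is, the union of all relations `R` on them with `R ⊆ CoStep R`. -/
def CoSub (A B : PreType DV TV C) : Prop :=
  ∃ R : PreType DV TV C → PreType DV TV C → Prop,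
    (∀ A' B', R A' B' → IsMuType A' ∧ IsMuType B') ∧
    (∀ A' B', R A' B' → CoStep R A' B') ∧ R A B

end PreType

end MuTypes

namespace MuTypes

namespace PreType

variable {DV TV C : Type*}

/-! Both relations are compared with a family of finite approximations. Contractivity lets every
expression be unfolded at its root to finitely many heads (`Head`), none of them a `μ` or a union.
`Approx ρ n A B` asks that each head of `A` be matched by a head of `B` with the same root symbol
(variables being compared by `ρ`) and with components related at level `n - 1`.

Coinductive subtyping is `Approx Eq n` for all `n` (`CoSub.approx`, `coSub_of_approx`). For the
converse, finiteness of the set of heads allows one matching head to be chosen for all levels at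
once (`IsOfKind.exists_headRel`).

Strong subtyping implies all approximations, by induction on derivations (`TyEq.approx`,
`StrongSub.approx`). The rules for `μ` need a second induction, on the level: a bound variable is
never a head of its body, so replacing it by expressions that agree up to level `n` gives results
that agree up to level `n + 1` (`Approx.fsub_succ`).

For the other direction, only finitely many expressions are reachable from `A` and `B` by taking
components and unfolding (`LC.exists_finite_closed`). For each pair `A ⪯ B` met on the way, new
recursive types `μV.L` and `μW.(R ⊕ B)` are built, where `L` and `R` are unions of matching heads
whose components come from recursive calls. A pair that is met again is answered by the variables
`V`, `W` themselves and the assumption `V ⪯ W`. Since `A ≃ L{A/V}` and `B ≃ (R ⊕ B){B/W}`, the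
contraction rule gives `A ≃ μV.L` and `B ≃ μW.(R ⊕ B)`, while the rule for `μ` gives `μV.L ⪯ μW.(R ⊕
B)` (`exists_guarded_bodies`, `solvable_of_guarded_bodies`, `solvable_of_approx`). -/

/-! ### Locally closed expressions and simultaneous instantiation -/

/-- All dangling indices are below `d`. -/
def LC : ℕ → PreType DV TV C → Prop
  | d, bvar j => j < d
  | _, var _ => True
  | _, const _ => True
  | d, comp D A => LC d D ∧ LC d A
  | d, arrow A B => LC d A ∧ LC d B
  | d, union A B => LC d A ∧ LC d B
  | d, mu _ A => LC (d + 1) A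

theorem LC.mono {A : PreType DV TV C} {d e : ℕ} (h : LC d A) (hde : d ≤ e) : LC e A := by
  induction A generalizing d e with
  | bvar j => exact lt_of_lt_of_le h hde
  | var V => trivial
  | const c => trivial
  | comp D A ihD ihA => exact ⟨ihD h.1 hde, ihA h.2 hde⟩
  | arrow A B ihA ihB => exact ⟨ihA h.1 hde, ihB h.2 hde⟩
  | union A B ihA ihB => exact ⟨ihA h.1 hde, ihB h.2 hde⟩
  | mu k A ih => exact ih (d := d + 1) (e := e + 1) h (by omega)

theorem WellSorted.lc {Γ : List Kind} {k : Kind} {A : PreType DV TV C} (h : WellSorted Γ k A) :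
    LC Γ.length A := by
  induction h with
  | bvar h => exact (List.getElem?_eq_some_iff.1 h).1
  | var V h => trivial
  | const c => trivial
  | comp _ _ ih₁ ih₂ => exact ⟨ih₁, ih₂⟩
  | arrow _ _ ih₁ ih₂ => exact ⟨ih₁, ih₂⟩
  | union _ _ ih₁ ih₂ => exact ⟨ih₁, ih₂⟩
  | mu _ ih => exact ih
  | ofData _ ih => exact ih

theorem IsOfKind.lc {k : Kind} {A : PreType DV TV C} (h : IsOfKind k A) : LC 0 A := h.1.lc

theorem IsMuType.lc {A : PreType DV TV C} (h : IsMuType A) : LC 0 A := h.1.lc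

theorem LC.instAt_eq {A u : PreType DV TV C} {d i : ℕ} (h : LC d A) (hi : d ≤ i) :
    instAt u i A = A := by
  induction A generalizing d i with
  | bvar j => simp only [LC] at h; simp only [instAt]; rw [if_neg (by omega)]
  | var V => rfl
  | const c => rfl
  | comp D A ihD ihA => simp only [instAt, ihD h.1 hi, ihA h.2 hi]
  | arrow A B ihA ihB => simp only [instAt, ihA h.1 hi, ihB h.2 hi]
  | union A B ihA ihB => simp only [instAt, ihA h.1 hi, ihB h.2 hi]
  | mu k A ih => simp only [instAt, ih (d := d + 1) (i := i + 1) h (by omega)]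

theorem LC.guardedAt {A : PreType DV TV C} {d i : ℕ} (h : LC d A) (hi : d ≤ i) :
    GuardedAt i A := by
  induction A generalizing d i with
  | bvar j => simp only [LC] at h; simp only [GuardedAt]; omega
  | var V => trivial
  | const c => trivial
  | comp D A ihD ihA => trivial
  | arrow A B ihA ihB => trivial
  | union A B ihA ihB => exact ⟨ihA h.1 hi, ihB h.2 hi⟩
  | mu k A ih => exact ih (d := d + 1) (i := i + 1) h (by omega)

/-- Simultaneous replacement of the indices that refer to the binders outside the `d` innermost
ones by the expressions `σ 0, σ 1, …`, which are meant to be locally closed. -/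
def bsub (σ : ℕ → PreType DV TV C) : ℕ → PreType DV TV C → PreType DV TV C
  | d, bvar j => if j < d then bvar j else σ (j - d)
  | _, var V => var V
  | _, const c => const c
  | d, comp D A => comp (bsub σ d D) (bsub σ d A)
  | d, arrow A B => arrow (bsub σ d A) (bsub σ d B)
  | d, union A B => union (bsub σ d A) (bsub σ d B)
  | d, mu k A => mu k (bsub σ (d + 1) A)

/-- Extension of an environment by an innermost entry. -/
def consEnv (u : PreType DV TV C) (σ : ℕ → PreType DV TV C) : ℕ → PreType DV TV C
  | 0 => u
  | i + 1 => σ i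

theorem LC.bsub_eq {A : PreType DV TV C} {σ : ℕ → PreType DV TV C} {d e : ℕ} (h : LC d A)
    (hde : d ≤ e) : bsub σ e A = A := by
  induction A generalizing d e with
  | bvar j => simp only [LC] at h; simp only [bsub]; rw [if_pos (by omega)]
  | var V => rfl
  | const c => rfl
  | comp D A ihD ihA => simp only [bsub, ihD h.1 hde, ihA h.2 hde]
  | arrow A B ihA ihB => simp only [bsub, ihA h.1 hde, ihB h.2 hde]
  | union A B ihA ihB => simp only [bsub, ihA h.1 hde, ihB h.2 hde]
  | mu k A ih => simp only [bsub, ih (d := d + 1) (e := e + 1) h (by omega)]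

/-- The values of `σ` have no dangling index, so the later instantiation leaves them alone. This is
what lets unfoldings and named bodies be expressed by extending an environment. -/
theorem instAt_bsub {σ : ℕ → PreType DV TV C} (hσ : ∀ i, LC 0 (σ i)) (u A : PreType DV TV C)
    (d : ℕ) : instAt u d (bsub σ (d + 1) A) = bsub (consEnv u σ) d A := by
  induction A generalizing d with
  | bvar j =>
    simp only [bsub]
    rcases lt_trichotomy j d with h | rfl | h
    · rw [if_pos (by omega), if_pos h]
      simp only [instAt]
      rw [if_neg (by omega)]
    · simp [instAt, consEnv]
    · rw [if_neg (by omega), if_neg (by omega), (hσ _).instAt_eq (Nat.zero_le _)]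
      obtain ⟨m, rfl⟩ : ∃ m, j = d + 1 + m := ⟨j - (d + 1), by omega⟩
      rw [show d + 1 + m - (d + 1) = m by omega, show d + 1 + m - d = m + 1 by omega]
      rfl
  | var V => rfl
  | const c => rfl
  | comp D A ihD ihA => simp only [bsub, instAt, ihD, ihA]
  | arrow A B ihA ihB => simp only [bsub, instAt, ihA, ihB]
  | union A B ihA ihB => simp only [bsub, instAt, ihA, ihB]
  | mu k A ih => simp only [bsub, instAt, ih]

theorem inst_bsub {σ : ℕ → PreType DV TV C} (hσ : ∀ i, LC 0 (σ i)) (u A : PreType DV TV C) :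
    (bsub σ 1 A).inst u = bsub (consEnv u σ) 0 A :=
  instAt_bsub hσ u A 0

/-- The constant environment is harmless because `d` is the only index that can escape. Preservation
of sorts and contractivity then has to be proved for `bsub` only. -/
theorem LC.instAt_eq_bsub {A : PreType DV TV C} {d : ℕ} (h : LC (d + 1) A)
    (u : PreType DV TV C) : instAt u d A = bsub (fun _ => u) d A := by
  induction A generalizing d with
  | bvar j =>
    simp only [LC] at h
    simp only [instAt, bsub]
    by_cases hj : j = d
    · rw [if_pos hj, if_neg (by omega)]
    · rw [if_neg hj, if_pos (by omega)]
  | var V => rfl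
  | const c => rfl
  | comp D A ihD ihA => simp only [bsub, instAt, ihD h.1, ihA h.2]
  | arrow A B ihA ihB => simp only [bsub, instAt, ihA h.1, ihB h.2]
  | union A B ihA ihB => simp only [bsub, instAt, ihA h.1, ihB h.2]
  | mu k A ih => simp only [bsub, instAt, ih (d := d + 1) h]

theorem WellSorted.weaken {Γ : List Kind} {k : Kind} {A : PreType DV TV C}
    (h : WellSorted Γ k A) (Δ : List Kind) : WellSorted (Γ ++ Δ) k A := by
  induction h with
  | bvar h =>
    refine .bvar ?_
    rw [List.getElem?_append_left (List.getElem?_eq_some_iff.1 h).1]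
    exact h
  | var V h => exact .var V h
  | const c => exact .const c
  | comp _ _ ih₁ ih₂ => exact .comp ih₁ ih₂
  | arrow _ _ ih₁ ih₂ => exact .arrow ih₁ ih₂
  | union _ _ ih₁ ih₂ => exact .union ih₁ ih₂
  | mu _ ih => exact .mu ih
  | ofData _ ih => exact .ofData ih

theorem WellSorted.bsub {Γ : List Kind} {k : Kind} {A : PreType DV TV C}
    {σ : ℕ → PreType DV TV C} (hσ : ∀ i l, Γ[i]? = some l → WellSorted [] l (σ i))
    {Δ : List Kind} (h : WellSorted (Δ ++ Γ) k A) :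
    WellSorted Δ k (PreType.bsub σ Δ.length A) := by
  generalize hE : Δ ++ Γ = E at h
  induction h generalizing Δ with
  | @bvar E i k h =>
    subst hE
    simp only [PreType.bsub]
    split_ifs with hi
    · rw [List.getElem?_append_left hi] at h
      exact .bvar h
    · rw [List.getElem?_append_right (by omega)] at h
      simpa using (hσ _ _ h).weaken Δ
  | var V h => exact .var V h
  | const c => exact .const c
  | comp _ _ ih₁ ih₂ => exact .comp (ih₁ hE) (ih₂ hE)
  | arrow _ _ ih₁ ih₂ => exact .arrow (ih₁ hE) (ih₂ hE)
  | union _ _ ih₁ ih₂ => exact .union (ih₁ hE) (ih₂ hE)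
  | @mu E k A _ ih => exact .mu (ih (Δ := k :: Δ) (by rw [← hE]; rfl))
  | ofData _ ih => exact .ofData (ih hE)

theorem GuardedAt.bsub {A : PreType DV TV C} {σ : ℕ → PreType DV TV C} (hσ : ∀ i, LC 0 (σ i))
    {i d : ℕ} (hi : i < d) (h : GuardedAt i A) : GuardedAt i (PreType.bsub σ d A) := by
  induction A generalizing i d with
  | bvar j =>
    simp only [PreType.bsub]
    split_ifs
    · exact h
    · exact (hσ _).guardedAt (Nat.zero_le _)
  | var V => trivial
  | const c => trivial
  | comp D A ihD ihA => trivial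
  | arrow A B ihA ihB => trivial
  | union A B ihA ihB => exact ⟨ihA hi h.1, ihB hi h.2⟩
  | mu k A ih => exact ih (i := i + 1) (d := d + 1) (by omega) h

theorem Contractive.bsub {A : PreType DV TV C} {σ : ℕ → PreType DV TV C}
    (hσ : ∀ i, LC 0 (σ i)) (hc : ∀ i, (σ i).Contractive) {d : ℕ} (h : A.Contractive) :
    (PreType.bsub σ d A).Contractive := by
  induction A generalizing d with
  | bvar j =>
    simp only [PreType.bsub]
    split_ifs
    · trivial
    · exact hc _
  | var V => trivial
  | const c => trivial
  | comp D A ihD ihA => exact ⟨ihD h.1, ihA h.2⟩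
  | arrow A B ihA ihB => exact ⟨ihA h.1, ihB h.2⟩
  | union A B ihA ihB => exact ⟨ihA h.1, ihB h.2⟩
  | mu k A ih => exact ⟨GuardedAt.bsub hσ (by omega) h.1, ih h.2⟩

theorem mem_fv_bsub {A : PreType DV TV C} {σ : ℕ → PreType DV TV C} {d : ℕ} {V : Var DV TV}
    (h : V ∈ (bsub σ d A).fv) : V ∈ A.fv ∨ ∃ i, V ∈ (σ i).fv := by
  induction A generalizing d with
  | bvar j =>
    simp only [bsub] at h
    split_ifs at h
    · exact .inl h
    · exact .inr ⟨_, h⟩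
  | var W => exact .inl h
  | const c => exact .inl h
  | comp D A ihD ihA => rcases h with h | h; exacts [(ihD h).imp_left .inl, (ihA h).imp_left .inr]
  | arrow A B ihA ihB => rcases h with h | h; exacts [(ihA h).imp_left .inl, (ihB h).imp_left .inr]
  | union A B ihA ihB => rcases h with h | h; exacts [(ihA h).imp_left .inl, (ihB h).imp_left .inr]
  | mu k A ih => exact ih h

/-! ### Sorts -/

theorem WellSorted.of_data {Γ : List Kind} {A : PreType DV TV C} (h : WellSorted Γ .data A)
    (k : Kind) : WellSorted Γ k A := by
  cases k
  exacts [h, .ofData h]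

theorem WellSorted.to_typ {Γ : List Kind} {k : Kind} {A : PreType DV TV C}
    (h : WellSorted Γ k A) : WellSorted Γ .typ A := by
  cases k
  exacts [.ofData h, h]

theorem IsOfKind.isMuType {k : Kind} {A : PreType DV TV C} (h : IsOfKind k A) : IsMuType A :=
  ⟨h.1.to_typ, h.2⟩

theorem WellSorted.comp_inv {Γ : List Kind} {k : Kind} {D A : PreType DV TV C}
    (h : WellSorted Γ k (PreType.comp D A)) : WellSorted Γ .data D ∧ WellSorted Γ .typ A := by
  generalize hE : PreType.comp D A = E at h
  induction h with
  | comp h₁ h₂ => cases hE; exact ⟨h₁, h₂⟩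
  | ofData _ ih => exact ih hE
  | _ => cases hE

theorem WellSorted.arrow_inv {Γ : List Kind} {k : Kind} {A B : PreType DV TV C}
    (h : WellSorted Γ k (PreType.arrow A B)) :
    k = .typ ∧ WellSorted Γ .typ A ∧ WellSorted Γ .typ B := by
  generalize hE : PreType.arrow A B = E at h
  induction h with
  | arrow h₁ h₂ => cases hE; exact ⟨rfl, h₁, h₂⟩
  | ofData _ ih => cases (ih hE).1
  | _ => cases hE

theorem WellSorted.union_inv {Γ : List Kind} {k : Kind} {A B : PreType DV TV C}
    (h : WellSorted Γ k (PreType.union A B)) : WellSorted Γ k A ∧ WellSorted Γ k B := by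
  generalize hE : PreType.union A B = E at h
  induction h with
  | union h₁ h₂ => cases hE; exact ⟨h₁, h₂⟩
  | ofData _ ih => exact ⟨.ofData (ih hE).1, .ofData (ih hE).2⟩
  | _ => cases hE

/-- The body of a recursive expression has the sort of its binder, whatever the sort at which the
expression is used. -/
theorem WellSorted.mu_inv {Γ : List Kind} {k l : Kind} {A : PreType DV TV C}
    (h : WellSorted Γ l (PreType.mu k A)) :
    WellSorted (k :: Γ) k A ∧ WellSorted Γ k (PreType.mu k A) ∧ (l = k ∨ k = .data) := by
  generalize hE : PreType.mu k A = E at h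
  induction h with
  | mu h => cases hE; exact ⟨h, .mu h, .inl rfl⟩
  | ofData _ ih =>
    obtain ⟨h₁, h₂, h₃⟩ := ih hE
    exact ⟨h₁, h₂, .inr (by rcases h₃ with h | h <;> simp [← h])⟩
  | _ => cases hE

theorem IsOfKind.comp_inv {k : Kind} {D A : PreType DV TV C} (h : IsOfKind k (comp D A)) :
    IsOfKind .data D ∧ IsOfKind .typ A :=
  ⟨⟨h.1.comp_inv.1, h.2.1⟩, ⟨h.1.comp_inv.2, h.2.2⟩⟩

theorem IsOfKind.arrow_inv {k : Kind} {A B : PreType DV TV C} (h : IsOfKind k (arrow A B)) :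
    IsOfKind .typ A ∧ IsOfKind .typ B :=
  ⟨⟨h.1.arrow_inv.2.1, h.2.1⟩, ⟨h.1.arrow_inv.2.2, h.2.2⟩⟩

theorem IsOfKind.union_inv {k : Kind} {A B : PreType DV TV C} (h : IsOfKind k (union A B)) :
    IsOfKind k A ∧ IsOfKind k B :=
  ⟨⟨h.1.union_inv.1, h.2.1⟩, ⟨h.1.union_inv.2, h.2.2⟩⟩

theorem IsOfKind.unfold {k l : Kind} {A : PreType DV TV C} (h : IsOfKind l (mu k A)) :
    IsOfKind l (A.inst (mu k A)) := by
  obtain ⟨h₁, h₂, h₃⟩ := h.1.mu_inv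
  have hlc : LC (0 + 1) A := h₁.lc
  -- The substituted recursive type must have the sort `k` of its binder; the sort `l` of use is
  -- recovered at the end, as it is `k` or `k` is `.data`.
  have hw : WellSorted [] k (A.inst (mu k A)) := by
    rw [inst, hlc.instAt_eq_bsub]
    refine WellSorted.bsub (Γ := [k]) (Δ := []) (fun i l hi => ?_) h₁
    obtain ⟨hi', rfl⟩ := List.getElem?_eq_some_iff.1 hi
    have : i = 0 := by simpa using hi'
    subst this
    exact h₂
  refine ⟨?_, ?_⟩
  · rcases h₃ with rfl | rfl
    exacts [hw, hw.of_data l]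
  · rw [inst, hlc.instAt_eq_bsub]
    exact Contractive.bsub (fun _ => h.lc) (fun _ => h.2) h.2.2

theorem not_isOfKind_bvar {k : Kind} {i : ℕ} : ¬ IsOfKind k (bvar i : PreType DV TV C) :=
  fun h => absurd h.lc (Nat.not_lt_zero i)

/-! ### Heads -/

/-- `Head A h`: the expression `h`, whose root is neither `μ` nor `⊕`, is one of the summands of
`A` after unfolding the recursive types at its root. -/
inductive Head : PreType DV TV C → PreType DV TV C → Prop
  | var (V : Var DV TV) : Head (var V) (var V)
  | const (c : C) : Head (const c) (const c)
  | comp (D A : PreType DV TV C) : Head (comp D A) (comp D A)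
  | arrow (A B : PreType DV TV C) : Head (arrow A B) (arrow A B)
  | union_l {A B h : PreType DV TV C} (hh : Head A h) : Head (union A B) h
  | union_r {A B h : PreType DV TV C} (hh : Head B h) : Head (union A B) h
  | mu {k : Kind} {A h : PreType DV TV C} (hh : Head (A.inst (mu k A)) h) : Head (mu k A) h

/-- The number of `μ` and `⊕` above all occurrences of `⊃` and `@`. -/
def hsize : PreType DV TV C → ℕ
  | union A B => A.hsize + B.hsize + 1
  | mu _ A => A.hsize + 1
  | _ => 0

/-- `hsize` ignores everything below `⊃` and `@`, and a guarded index occurs only there. Hence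
unfolding a contractive `μ` strictly decreases `hsize`, which makes the heads computable by
recursion. -/
theorem GuardedAt.hsize_instAt {A : PreType DV TV C} (u : PreType DV TV C) {i : ℕ}
    (h : GuardedAt i A) : (instAt u i A).hsize = A.hsize := by
  induction A generalizing i with
  | bvar j => simp only [GuardedAt] at h; simp only [instAt, if_neg h]
  | union A B ihA ihB => simp only [instAt, hsize, ihA h.1, ihB h.2]
  | mu k A ih => simp only [instAt, hsize, ih (i := i + 1) h]
  | _ => rfl

theorem IsOfKind.hsize_unfold {k l : Kind} {A : PreType DV TV C} (h : IsOfKind l (mu k A)) :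
    (A.inst (mu k A)).hsize < (mu k A).hsize := by
  rw [inst, GuardedAt.hsize_instAt _ h.2.1, hsize]
  omega

/-- Induction along the computation of the heads. -/
theorem IsOfKind.head_induction {k : Kind} {motive : PreType DV TV C → Prop}
    (var : ∀ V, IsOfKind k (var V : PreType DV TV C) → motive (var V))
    (const : ∀ c, IsOfKind k (const c : PreType DV TV C) → motive (const c))
    (comp : ∀ D A, IsOfKind k (comp D A) → motive (comp D A))
    (arrow : ∀ A B, IsOfKind k (arrow A B) → motive (arrow A B))
    (union : ∀ A B, IsOfKind k (union A B) → motive A → motive B → motive (union A B))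
    (mu : ∀ l A, IsOfKind k (mu l A) → motive (A.inst (mu l A)) → motive (mu l A))
    {A : PreType DV TV C} (hA : IsOfKind k A) : motive A := by
  induction hn : A.hsize using Nat.strong_induction_on generalizing A with
  | _ n ih =>
    subst hn
    cases A with
    | bvar i => exact (not_isOfKind_bvar hA).elim
    | var V => exact var V hA
    | const c => exact const c hA
    | comp D A => exact comp D A hA
    | arrow A B => exact arrow A B hA
    | union A B =>
      exact union A B hA (ih _ (by simp only [hsize]; omega) hA.union_inv.1 rfl)
        (ih _ (by simp only [hsize]; omega) hA.union_inv.2 rfl)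
    | mu l A => exact mu l A hA (ih _ hA.hsize_unfold hA.unfold rfl)

theorem head_union {A B h : PreType DV TV C} : Head (union A B) h ↔ Head A h ∨ Head B h :=
  ⟨fun hh => by cases hh with
    | union_l hh => exact .inl hh
    | union_r hh => exact .inr hh, fun hh => hh.elim .union_l .union_r⟩

theorem head_mu {k : Kind} {A h : PreType DV TV C} :
    Head (mu k A) h ↔ Head (A.inst (mu k A)) h :=
  ⟨fun hh => by cases hh with | mu hh => exact hh, .mu⟩

theorem Head.isOfKind {k : Kind} {A h : PreType DV TV C} (hh : Head A h) (hA : IsOfKind k A) :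
    IsOfKind k h := by
  induction hh with
  | union_l _ ih => exact ih hA.union_inv.1
  | union_r _ ih => exact ih hA.union_inv.2
  | mu _ ih => exact ih hA.unfold
  | _ => exact hA

theorem IsOfKind.finite_head {k : Kind} {A : PreType DV TV C} (hA : IsOfKind k A) :
    {h | Head A h}.Finite := by
  refine IsOfKind.head_induction (motive := fun A => {h | Head A h}.Finite) ?_ ?_ ?_ ?_
    (fun A B _ ihA ihB => by simpa only [head_union, Set.ofPred_or] using ihA.union ihB)
    (fun l A _ ih => by simpa only [head_mu] using ih) hA
  all_goals intros; exact (Set.finite_singleton _).subset fun h hh => by cases hh; rfl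

/-! ### Approximations of coinductive subtyping -/

/-- The rule of coinductive subtyping for expressions whose roots are neither `μ` nor `⊕`, with
`ρ` comparing the variables and `R` comparing the components. -/
inductive HeadRel (ρ : Var DV TV → Var DV TV → Prop)
    (R : PreType DV TV C → PreType DV TV C → Prop) : PreType DV TV C → PreType DV TV C → Prop
  | var {V W : Var DV TV} (h : ρ V W) : HeadRel ρ R (var V) (var W)
  | const (c : C) : HeadRel ρ R (const c) (const c)
  | comp {D D' A A' : PreType DV TV C} (h₁ : R D D') (h₂ : R A A') :
      HeadRel ρ R (comp D A) (comp D' A')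
  | arrow {A A' B B' : PreType DV TV C} (h₁ : R A' A) (h₂ : R B B') :
      HeadRel ρ R (arrow A B) (arrow A' B')

/-- Subtyping of the unfoldings up to `n` nested occurrences of `⊃` and `@`, with variables
compared by `ρ`. -/
def Approx (ρ : Var DV TV → Var DV TV → Prop) :
    ℕ → PreType DV TV C → PreType DV TV C → Prop
  | 0, _, _ => True
  | n + 1, A, B => ∀ h, Head A h → ∃ h', Head B h' ∧ HeadRel ρ (Approx ρ n) h h'

theorem HeadRel.mono {ρ ρ' : Var DV TV → Var DV TV → Prop}
    {R R' : PreType DV TV C → PreType DV TV C → Prop} (hρ : ∀ x y, ρ x y → ρ' x y)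
    (hR : ∀ A B, R A B → R' A B) {A B : PreType DV TV C} (h : HeadRel ρ R A B) :
    HeadRel ρ' R' A B := by
  cases h with
  | var h => exact .var (hρ _ _ h)
  | const c => exact .const c
  | comp h₁ h₂ => exact .comp (hR _ _ h₁) (hR _ _ h₂)
  | arrow h₁ h₂ => exact .arrow (hR _ _ h₁) (hR _ _ h₂)

variable {ρ ρ' : Var DV TV → Var DV TV → Prop} {n : ℕ} {A B E : PreType DV TV C}

theorem Approx.mono_var (hρ : ∀ x y, ρ x y → ρ' x y) (h : Approx ρ n A B) : Approx ρ' n A B := by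
  induction n generalizing A B with
  | zero => trivial
  | succ n ih =>
    intro a ha
    obtain ⟨b, hb, hab⟩ := h a ha
    exact ⟨b, hb, hab.mono hρ fun _ _ => ih⟩

theorem Approx.of_succ (h : Approx ρ (n + 1) A B) : Approx ρ n A B := by
  induction n generalizing A B with
  | zero => trivial
  | succ n ih =>
    intro a ha
    obtain ⟨b, hb, hab⟩ := h a ha
    exact ⟨b, hb, hab.mono (fun _ _ => id) fun _ _ => ih⟩

theorem approx_antitone (ρ : Var DV TV → Var DV TV → Prop) (A B : PreType DV TV C) :
    Antitone fun n => Approx ρ n A B :=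
  antitone_nat_of_succ_le fun _ => Approx.of_succ

theorem Head.headRel_refl {R : PreType DV TV C → PreType DV TV C → Prop} (hρ : ∀ x, ρ x x)
    (hR : ∀ A, R A A) {h : PreType DV TV C} (hh : Head A h) : HeadRel ρ R h h := by
  induction hh with
  | var V => exact .var (hρ V)
  | const c => exact .const c
  | comp D A => exact .comp (hR D) (hR A)
  | arrow A B => exact .arrow (hR A) (hR B)
  | union_l _ ih => exact ih
  | union_r _ ih => exact ih
  | mu _ ih => exact ih

theorem Approx.refl (hρ : ∀ x, ρ x x) (n : ℕ) (A : PreType DV TV C) : Approx ρ n A A := by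
  induction n generalizing A with
  | zero => trivial
  | succ n ih => exact fun a ha => ⟨a, ha, ha.headRel_refl hρ ih⟩

theorem Approx.of_head (hρ : ∀ x, ρ x x) (n : ℕ) (h : ∀ a, Head A a → Head B a) :
    Approx ρ n A B := by
  cases n with
  | zero => trivial
  | succ n => exact fun a ha => ⟨a, h a ha, ha.headRel_refl hρ (Approx.refl hρ n)⟩

theorem HeadRel.trans {R : PreType DV TV C → PreType DV TV C → Prop}
    (hρ : ∀ x y z, ρ x y → ρ y z → ρ x z) (hR : ∀ A B E, R A B → R B E → R A E)
    (h₁ : HeadRel ρ R A B) (h₂ : HeadRel ρ R B E) : HeadRel ρ R A E := by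
  cases h₁ with
  | var h => cases h₂ with | var h' => exact .var (hρ _ _ _ h h')
  | const c => exact h₂
  | comp h₁ h₁' => cases h₂ with | comp h₂ h₂' => exact .comp (hR _ _ _ h₁ h₂) (hR _ _ _ h₁' h₂')
  | arrow h₁ h₁' =>
    cases h₂ with | arrow h₂ h₂' => exact .arrow (hR _ _ _ h₂ h₁) (hR _ _ _ h₁' h₂')

theorem Approx.trans (hρ : ∀ x y z, ρ x y → ρ y z → ρ x z) (h₁ : Approx ρ n A B)
    (h₂ : Approx ρ n B E) : Approx ρ n A E := by
  induction n generalizing A B E with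
  | zero => trivial
  | succ n ih =>
    intro a ha
    obtain ⟨b, hb, hab⟩ := h₁ a ha
    obtain ⟨e, he, hbe⟩ := h₂ b hb
    exact ⟨e, he, hab.trans hρ (fun _ _ _ => ih) hbe⟩

theorem Approx.union_l (h₁ : Approx ρ n A E) (h₂ : Approx ρ n B E) :
    Approx ρ n (union A B) E := by
  cases n with
  | zero => trivial
  | succ n => exact fun a ha => (head_union.1 ha).elim (h₁ a) (h₂ a)

theorem Approx.union_r1 (h : Approx ρ n A B) : Approx ρ n A (union B E) := by
  cases n with
  | zero => trivial
  | succ n => exact fun a ha => (h a ha).imp fun _ hb => ⟨.union_l hb.1, hb.2⟩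

theorem Approx.union_r2 (h : Approx ρ n A E) : Approx ρ n A (union B E) := by
  cases n with
  | zero => trivial
  | succ n => exact fun a ha => (h a ha).imp fun _ hb => ⟨.union_r hb.1, hb.2⟩

theorem Approx.comp {D D' A A' : PreType DV TV C} (h₁ : Approx ρ n D D')
    (h₂ : Approx ρ n A A') : Approx ρ n (comp D A) (PreType.comp D' A') := by
  cases n with
  | zero => trivial
  | succ n =>
    intro a ha
    cases ha
    exact ⟨_, .comp _ _, .comp h₁.of_succ h₂.of_succ⟩

theorem Approx.arrow {A A' B B' : PreType DV TV C} (h₁ : Approx ρ n A' A)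
    (h₂ : Approx ρ n B B') : Approx ρ n (arrow A B) (PreType.arrow A' B') := by
  cases n with
  | zero => trivial
  | succ n =>
    intro a ha
    cases ha
    exact ⟨_, .arrow _ _, .arrow h₁.of_succ h₂.of_succ⟩

/-- For an antitone family of predicates on the naturals indexed by a finite set, if each number
satisfies one of them, then one of them holds everywhere. -/
theorem exists_forall_of_antitone {α : Type*} {s : Set α} (hs : s.Finite) {p : α → ℕ → Prop}
    (hp : ∀ a, Antitone (p a)) (h : ∀ n, ∃ a ∈ s, p a n) : ∃ a ∈ s, ∀ n, p a n := by
  by_contra! hc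
  have : ∀ a : α, ∃ n, a ∈ s → ¬ p a n := fun a => by
    by_cases ha : a ∈ s
    · obtain ⟨n, hn⟩ := hc a ha
      exact ⟨n, fun _ => hn⟩
    · exact ⟨0, fun h => (ha h).elim⟩
  choose f hf using this
  -- `N` bounds one failing index for each element of `s`, so by antitonicity all of them fail at
  -- `N`.
  obtain ⟨N, hN⟩ := (hs.image f).bddAbove
  obtain ⟨a, ha, hpa⟩ := h N
  exact hf a ha (hp a (hN ⟨a, ha, rfl⟩) hpa)

theorem HeadRel.antitone (ρ : Var DV TV → Var DV TV → Prop) (a b : PreType DV TV C) :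
    Antitone fun n => HeadRel ρ (Approx ρ n) a b :=
  fun _ _ hmn h => h.mono (fun _ _ => id) fun _ _ => approx_antitone ρ _ _ hmn

/-- Level `0` already fixes the shape of `a` and `b`; the other levels only constrain the
components. -/
theorem headRel_forall {a b : PreType DV TV C} (h : ∀ n, HeadRel ρ (Approx ρ n) a b) :
    HeadRel ρ (fun A B => ∀ n, Approx ρ n A B) a b := by
  cases h 0 with
  | var h' => exact .var h'
  | const c => exact .const c
  | comp _ _ =>
    exact .comp (fun n => by cases h n with | comp h₁ h₂ => exact h₁)
      (fun n => by cases h n with | comp h₁ h₂ => exact h₂)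
  | arrow _ _ =>
    exact .arrow (fun n => by cases h n with | arrow h₁ h₂ => exact h₁)
      (fun n => by cases h n with | arrow h₁ h₂ => exact h₂)

/-- A compactness argument: `B` has finitely many heads and the approximations are antitone in `n`,
so a single head of `B` matches `a` at every level. -/
theorem IsOfKind.exists_headRel {k : Kind} (hB : IsOfKind k B) (h : ∀ n, Approx ρ n A B)
    {a : PreType DV TV C} (ha : Head A a) :
    ∃ b, Head B b ∧ HeadRel ρ (fun A B => ∀ n, Approx ρ n A B) a b := by
  obtain ⟨b, hb, hab⟩ := exists_forall_of_antitone hB.finite_head (HeadRel.antitone ρ a)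
    fun n => h (n + 1) a ha
  exact ⟨b, hb, headRel_forall hab⟩

/-! ### Coinductive subtyping and its approximations -/

theorem summands_ne_nil (A : PreType DV TV C) : A.summands ≠ [] := by
  cases A with
  | union A B => simp [summands, summands_ne_nil A]
  | _ => simp [summands]

theorem exists_union_of_one_lt_length (h : 1 < A.summands.length) :
    ∃ A₁ A₂, A = union A₁ A₂ := by
  cases A with
  | union A B => exact ⟨A, B, rfl⟩
  | _ => simp [summands] at h

theorem one_lt_length_summands_union (A B : PreType DV TV C) :
    1 < (union A B).summands.length := by
  have h₁ := List.length_pos_iff.2 (summands_ne_nil A)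
  have h₂ := List.length_pos_iff.2 (summands_ne_nil B)
  simp only [summands, List.length_append]
  omega

theorem head_iff_exists_summand (A h : PreType DV TV C) :
    Head A h ↔ ∃ A' ∈ A.summands, Head A' h := by
  induction A with
  | union A B ihA ihB =>
    rw [head_union, ihA, ihB]
    simp only [summands, List.mem_append, or_and_right, exists_or]
  | _ => simp [summands]

theorem hsize_le_of_mem_summands {A' : PreType DV TV C} (h : A' ∈ A.summands) :
    A'.hsize ≤ A.hsize := by
  induction A with
  | union A B ihA ihB =>
    simp only [hsize]
    rcases List.mem_append.1 h with h | h
    · have := ihA h; omega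
    · have := ihB h; omega
  | _ => simp only [summands, List.mem_singleton] at h; rw [h]

theorem hsize_lt_of_mem_summands {A' : PreType DV TV C} (hA : 1 < A.summands.length)
    (h : A' ∈ A.summands) : A'.hsize < A.hsize := by
  obtain ⟨A₁, A₂, rfl⟩ := exists_union_of_one_lt_length hA
  simp only [hsize]
  rcases List.mem_append.1 h with h | h
  · have := hsize_le_of_mem_summands h; omega
  · have := hsize_le_of_mem_summands h; omega

theorem IsOfKind.of_mem_summands {k : Kind} {A' : PreType DV TV C} (hA : IsOfKind k A)
    (h : A' ∈ A.summands) : IsOfKind k A' := by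
  induction A with
  | union A B ihA ihB =>
    rcases List.mem_append.1 h with h | h
    · exact ihA hA.union_inv.1 h
    · exact ihB hA.union_inv.2 h
  | _ => simp only [summands, List.mem_singleton] at h; rwa [h]

/-- The rules for `@` and `⊃` consume one level. The rules for `μ` and `⊕` keep the level but
decrease `hsize`, so an inner induction on the total `hsize` handles them. -/
theorem CoSub.approx (h : CoSub A B) (n : ℕ) : Approx Eq n A B := by
  obtain ⟨R, hT, hR, hAB⟩ := h
  induction n generalizing A B with
  | zero => trivial
  | succ n ih =>
    induction hs : A.hsize + B.hsize using Nat.strong_induction_on generalizing A B with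
    | _ s ihs =>
      subst hs
      cases hR A B hAB with
      | refl_var V => exact Approx.refl (fun _ => rfl) _ _
      | refl_const c => exact Approx.refl (fun _ => rfl) _ _
      | comp h₁ h₂ =>
        intro a ha
        cases ha
        exact ⟨_, .comp _ _, .comp (ih h₁) (ih h₂)⟩
      | arrow h₁ h₂ =>
        intro a ha
        cases ha
        exact ⟨_, .arrow _ _, .arrow (ih h₁) (ih h₂)⟩
      | mu_l h =>
        have := (hT _ _ hAB).1.hsize_unfold
        exact fun a ha => ihs _ (by omega) h rfl a (head_mu.1 ha)
      | mu_r hA h =>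
        have := (hT _ _ hAB).2.hsize_unfold
        exact fun a ha => (ihs _ (by omega) h rfl a ha).imp fun b hb => ⟨head_mu.2 hb.1, hb.2⟩
      | union_l hn _ h =>
        intro a ha
        obtain ⟨A', hA', ha⟩ := (head_iff_exists_summand _ _).1 ha
        have := hsize_lt_of_mem_summands hn hA'
        exact ihs _ (by omega) (h A' hA') rfl a ha
      | union_r hm _ _ h =>
        obtain ⟨B', hB', h⟩ := h
        have := hsize_lt_of_mem_summands hm hB'
        exact fun a ha => (ihs _ (by omega) h rfl a ha).imp fun b hb =>
          ⟨(head_iff_exists_summand _ _).2 ⟨B', hB', hb.1⟩, hb.2⟩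

theorem approx_of_forall_head (h : ∀ a, Head A a → ∃ E, (∀ n, Approx ρ n E B) ∧ Head E a)
    (n : ℕ) : Approx ρ n A B := by
  cases n with
  | zero => trivial
  | succ n =>
    intro a ha
    obtain ⟨E, hE, hEa⟩ := h a ha
    exact hE (n + 1) a hEa

theorem coStep_of_headRel {R : PreType DV TV C → PreType DV TV C → Prop} {a b : PreType DV TV C}
    (h : HeadRel Eq R a b) : CoStep R a b := by
  cases h with
  | var h => cases h; exact .refl_var _
  | const c => exact .refl_const c
  | comp h₁ h₂ => exact .comp h₁ h₂
  | arrow h₁ h₂ => exact .arrow h₁ h₂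

theorem IsOfKind.isMu_or_isUnion_or_head {k : Kind} (hA : IsOfKind k A) :
    (∃ l A', A = mu l A') ∨ (∃ A₁ A₂, A = union A₁ A₂) ∨
      ¬ A.IsMu ∧ ¬ A.IsUnion ∧ Head A A ∧ ∀ h, Head A h → h = A := by
  cases A with
  | bvar i => exact (not_isOfKind_bvar hA).elim
  | mu l A => exact .inl ⟨l, A, rfl⟩
  | union A B => exact .inr (.inl ⟨A, B, rfl⟩)
  | _ => exact .inr (.inr ⟨id, id, by constructor, fun h hh => by cases hh; rfl⟩)

theorem HeadRel.and_isMuType {R : PreType DV TV C → PreType DV TV C → Prop} {a b : PreType DV TV C}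
    (ha : IsMuType a) (hb : IsMuType b) (h : HeadRel ρ R a b) :
    HeadRel ρ (fun A B => IsMuType A ∧ IsMuType B ∧ R A B) a b := by
  cases h with
  | var h => exact .var h
  | const c => exact .const c
  | comp h₁ h₂ =>
    exact .comp ⟨ha.comp_inv.1.isMuType, hb.comp_inv.1.isMuType, h₁⟩
      ⟨ha.comp_inv.2, hb.comp_inv.2, h₂⟩
  | arrow h₁ h₂ =>
    exact .arrow ⟨hb.arrow_inv.1, ha.arrow_inv.1, h₁⟩ ⟨ha.arrow_inv.2, hb.arrow_inv.2, h₂⟩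

/-- The relation "approximated at every level" is itself closed backwards under the rules. The case
distinctions follow their side conditions: `μ` on the left, `μ` on the right, `⊕` on the left, `⊕`
on the right, and finally two heads. -/
theorem coSub_of_approx (hA : IsMuType A) (hB : IsMuType B) (h : ∀ n, Approx Eq n A B) :
    CoSub A B := by
  refine ⟨fun A B => IsMuType A ∧ IsMuType B ∧ ∀ n, Approx Eq n A B,
    fun _ _ h => ⟨h.1, h.2.1⟩, ?_, hA, hB, h⟩
  clear! A B
  rintro A B ⟨hA, hB, h⟩
  rcases IsOfKind.isMu_or_isUnion_or_head hA with ⟨k, A, rfl⟩ | hA'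
  · exact .mu_l ⟨hA.unfold, hB, approx_of_forall_head fun a ha => ⟨_, h, .mu ha⟩⟩
  have hA'' : ¬ A.IsMu := by
    rcases hA' with ⟨_, _, rfl⟩ | h
    exacts [id, h.1]
  rcases IsOfKind.isMu_or_isUnion_or_head hB with ⟨k, B, rfl⟩ | hB'
  · refine .mu_r hA'' ⟨hA, hB.unfold, fun n => (h n).trans (fun _ _ _ => Eq.trans) ?_⟩
    exact Approx.of_head (fun _ => rfl) n fun _ => head_mu.1
  have hB'' : ¬ B.IsMu := by
    rcases hB' with ⟨_, _, rfl⟩ | h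
    exacts [id, h.1]
  rcases hA' with ⟨A₁, A₂, rfl⟩ | ⟨-, hA', hhA, hA₁⟩
  · refine .union_l (one_lt_length_summands_union _ _) hB'' fun A' hA' =>
      ⟨IsOfKind.of_mem_summands hA hA', hB, approx_of_forall_head fun a ha => ⟨_, h, ?_⟩⟩
    exact (head_iff_exists_summand _ _).2 ⟨_, hA', ha⟩
  -- `A` is its own only head. Since `b` does not depend on the level, neither does the summand of
  -- `B` chosen below.
  obtain ⟨b, hb, hAb⟩ := IsOfKind.exists_headRel hB h hhA
  rcases hB' with ⟨B₁, B₂, rfl⟩ | ⟨-, hB', hhB, hB₁⟩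
  · obtain ⟨B', hB', hB'b⟩ := (head_iff_exists_summand _ _).1 hb
    refine .union_r (one_lt_length_summands_union _ _) hA'' hA'
      ⟨B', hB', hA, IsOfKind.of_mem_summands hB hB', fun n => ?_⟩
    cases n with
    | zero => trivial
    | succ n =>
      intro a ha
      cases hA₁ a ha
      exact ⟨b, hB'b, hAb.mono (fun _ _ => id) fun _ _ h => h n⟩
  · cases hB₁ b hb
    exact coStep_of_headRel (hAb.and_isMuType hA hB)

/-! ### Substitution for free variables -/

/-- Simultaneous substitution of the expressions `σ V`, which are meant to be locally closed, for
the free variables `V`. -/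
def fsub (σ : Var DV TV → PreType DV TV C) : PreType DV TV C → PreType DV TV C
  | bvar j => bvar j
  | var V => σ V
  | const c => const c
  | comp D A => comp (fsub σ D) (fsub σ A)
  | arrow A B => arrow (fsub σ A) (fsub σ B)
  | union A B => union (fsub σ A) (fsub σ B)
  | mu k A => mu k (fsub σ A)

variable {σ τ : Var DV TV → PreType DV TV C} {A B P Q h u : PreType DV TV C}

theorem fsub_instAt (hσ : ∀ V, LC 0 (σ V)) (u A : PreType DV TV C) (i : ℕ) :
    fsub σ (instAt u i A) = instAt (fsub σ u) i (fsub σ A) := by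
  induction A generalizing i with
  | bvar j => simp only [instAt, fsub]; split_ifs <;> rfl
  | var V => simp only [instAt, fsub, (hσ V).instAt_eq (Nat.zero_le _)]
  | const c => rfl
  | comp D A ihD ihA => simp only [fsub, instAt, ihD, ihA]
  | arrow A B ihA ihB => simp only [fsub, instAt, ihA, ihB]
  | union A B ihA ihB => simp only [fsub, instAt, ihA, ihB]
  | mu k A ih => simp only [fsub, instAt, ih]

theorem fsub_congr (h : ∀ V ∈ A.fv, σ V = τ V) : fsub σ A = fsub τ A := by
  induction A with
  | bvar j => rfl
  | var V => exact h V rfl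
  | const c => rfl
  | comp D A ihD ihA =>
    simp only [fsub, ihD fun V hV => h V (.inl hV), ihA fun V hV => h V (.inr hV)]
  | arrow A B ihA ihB =>
    simp only [fsub, ihA fun V hV => h V (.inl hV), ihB fun V hV => h V (.inr hV)]
  | union A B ihA ihB =>
    simp only [fsub, ihA fun V hV => h V (.inl hV), ihB fun V hV => h V (.inr hV)]
  | mu k A ih => simp only [fsub, ih h]

theorem fsub_var (A : PreType DV TV C) : fsub var A = A := by
  induction A with
  | bvar j => rfl
  | var V => rfl
  | const c => rfl
  | comp D A ihD ihA => simp only [fsub, ihD, ihA]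
  | arrow A B ihA ihB => simp only [fsub, ihA, ihB]
  | union A B ihA ihB => simp only [fsub, ihA, ihB]
  | mu k A ih => simp only [fsub, ih]

theorem fsub_eq_self (h : ∀ V ∈ A.fv, σ V = var V) : fsub σ A = A := by
  rw [fsub_congr h, fsub_var]

open Classical in
/-- Substitution of `a` for the single variable `V`. -/
noncomputable def single (V : Var DV TV) (a : PreType DV TV C) : Var DV TV → PreType DV TV C :=
  Function.update var V a

theorem single_self (V : Var DV TV) (a : PreType DV TV C) : single V a V = a := by
  simp [single]

theorem single_of_ne {V W : Var DV TV} (hW : W ≠ V) (a : PreType DV TV C) :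
    single V a W = var W := by
  simp [single, hW]

theorem single_lc {a : PreType DV TV C} (ha : LC 0 a) (V W : Var DV TV) :
    LC 0 (single V a W) := by
  by_cases hW : W = V
  · rwa [hW, single_self]
  · rw [single_of_ne hW]; trivial

/-- This passes from a premise about bodies with a named variable to arbitrary instances of the
bodies. -/
theorem fsub_single_inst {V : Var DV TV} {a : PreType DV TV C} (hV : V ∉ A.fv) (ha : LC 0 a) :
    fsub (single V a) (A.inst (var V)) = A.inst a := by
  rw [inst, fsub_instAt (single_lc ha V), fsub, single_self, inst, fsub_eq_self]
  exact fun W hW => single_of_ne (fun h : W = V => hV (h ▸ hW)) a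

theorem Head.fsub (hσ : ∀ V, LC 0 (σ V)) (hh : Head P h) :
    (∃ V, h = PreType.var V) ∨ Head (fsub σ P) (fsub σ h) := by
  induction hh with
  | var V => exact .inl ⟨V, rfl⟩
  | const c => exact .inr (.const c)
  | comp D A => exact .inr (.comp _ _)
  | arrow A B => exact .inr (.arrow _ _)
  | union_l _ ih => exact ih.imp_right .union_l
  | union_r _ ih => exact ih.imp_right .union_r
  | mu _ ih =>
    rw [inst, fsub_instAt hσ] at ih
    exact ih.imp_right .mu

theorem Head.fsub_var (hσ : ∀ V, LC 0 (σ V)) {V : Var DV TV} (hh : Head P (PreType.var V))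
    (hV : Head (σ V) h) : Head (PreType.fsub σ P) h := by
  generalize hv : PreType.var V = v at hh
  induction hh with
  | var W => cases hv; exact hV
  | union_l _ ih => exact .union_l (ih hv)
  | union_r _ ih => exact .union_r (ih hv)
  | mu _ ih =>
    have := ih hv
    rw [inst, fsub_instAt hσ] at this
    exact .mu this
  | _ => cases hv

theorem head_fsub (hσ : ∀ V, LC 0 (σ V)) (hh : Head (fsub σ P) h) :
    (∃ V, Head P (var V) ∧ Head (σ V) h) ∨ ∃ h', Head P h' ∧ (∀ V, h' ≠ var V) ∧ h = fsub σ h' := by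
  generalize hF : fsub σ P = F at hh
  induction hh generalizing P with
  | var V =>
    cases P <;> simp only [fsub, reduceCtorEq] at hF
    exact .inl ⟨_, .var _, hF ▸ .var V⟩
  | const c =>
    cases P <;> simp only [fsub, reduceCtorEq] at hF
    · exact .inl ⟨_, .var _, hF ▸ .const c⟩
    · exact .inr ⟨_, .const _, nofun, hF.symm⟩
  | comp D A =>
    cases P <;> simp only [fsub, reduceCtorEq] at hF
    · exact .inl ⟨_, .var _, hF ▸ .comp D A⟩
    · exact .inr ⟨_, .comp _ _, nofun, hF.symm⟩
  | arrow A B =>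
    cases P <;> simp only [fsub, reduceCtorEq] at hF
    · exact .inl ⟨_, .var _, hF ▸ .arrow A B⟩
    · exact .inr ⟨_, .arrow _ _, nofun, hF.symm⟩
  | union_l hh ih =>
    cases P <;> simp only [fsub, reduceCtorEq] at hF
    · exact .inl ⟨_, .var _, hF ▸ .union_l hh⟩
    · cases hF
      exact (ih rfl).imp (fun ⟨V, h₁, h₂⟩ => ⟨V, .union_l h₁, h₂⟩)
        fun ⟨h', h₁, h₂⟩ => ⟨h', .union_l h₁, h₂⟩
  | union_r hh ih =>
    cases P <;> simp only [fsub, reduceCtorEq] at hF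
    · exact .inl ⟨_, .var _, hF ▸ .union_r hh⟩
    · cases hF
      exact (ih rfl).imp (fun ⟨V, h₁, h₂⟩ => ⟨V, .union_r h₁, h₂⟩)
        fun ⟨h', h₁, h₂⟩ => ⟨h', .union_r h₁, h₂⟩
  | mu hh ih =>
    cases P <;> simp only [fsub, reduceCtorEq] at hF
    · exact .inl ⟨_, .var _, hF ▸ .mu hh⟩
    · cases hF
      exact (ih (fsub_instAt hσ _ _ _)).imp (fun ⟨V, h₁, h₂⟩ => ⟨V, .mu h₁, h₂⟩)
        fun ⟨h', h₁, h₂⟩ => ⟨h', .mu h₁, h₂⟩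

/-! ### Variables that are not heads -/

/-- The variable `V` occurs in the expression only under `⊃` or `@`, if at all. -/
def NotExposed (V : Var DV TV) : PreType DV TV C → Prop
  | var W => W ≠ V
  | union A B => A.NotExposed V ∧ B.NotExposed V
  | mu _ A => A.NotExposed V
  | _ => True

theorem notExposed_of_not_mem_fv {V : Var DV TV} (h : V ∉ A.fv) : A.NotExposed V := by
  induction A with
  | var W => exact fun hW => h (hW ▸ rfl)
  | union A B ihA ihB => exact ⟨ihA fun hV => h (.inl hV), ihB fun hV => h (.inr hV)⟩
  | mu k A ih => exact ih h
  | _ => trivial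

theorem NotExposed.instAt {V : Var DV TV} {i : ℕ} (hA : A.NotExposed V) (hu : u.NotExposed V) :
    (instAt u i A).NotExposed V := by
  induction A generalizing i with
  | bvar j =>
    simp only [PreType.instAt]
    split_ifs
    exacts [hu, trivial]
  | var W => exact hA
  | union A B ihA ihB => exact ⟨ihA hA.1, ihB hA.2⟩
  | mu k A ih => exact ih (i := i + 1) hA
  | _ => trivial

theorem GuardedAt.notExposed {V : Var DV TV} {i : ℕ} (hA : GuardedAt i A) (hV : V ∉ A.fv) :
    (instAt (var V) i A).NotExposed V := by
  induction A generalizing i with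
  | bvar j => simp only [GuardedAt] at hA; simp only [instAt, if_neg hA]; trivial
  | var W => exact fun hW => hV (hW ▸ rfl)
  | union A B ihA ihB =>
    exact ⟨ihA hA.1 fun h => hV (.inl h), ihB hA.2 fun h => hV (.inr h)⟩
  | mu k A ih => exact ih (i := i + 1) hA hV
  | _ => trivial

theorem NotExposed.ne_of_head {V W : Var DV TV} (hP : P.NotExposed V) (hh : Head P (var W)) :
    W ≠ V := by
  generalize hv : PreType.var W = v at hh
  induction hh with
  | var W' => cases hv; exact hP
  | union_l _ ih => exact ih hP.1 hv
  | union_r _ ih => exact ih hP.2 hv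
  | mu _ ih => exact ih (NotExposed.instAt hP hP) hv
  | _ => cases hv

/-! ### Soundness -/

variable {ρ ρ' : Var DV TV → Var DV TV → Prop} {n : ℕ}

/-- Substitution preserves approximations; at the outermost level only the variables among the
heads matter. -/
theorem Approx.fsub_succ (hσ : ∀ V, LC 0 (σ V)) (hτ : ∀ V, LC 0 (τ V))
    (h₁ : ∀ x y, ρ' x y → Approx ρ n (σ x) (τ y))
    (h₂ : ∀ x y, ρ' x y → Approx ρ n (τ x) (σ y))
    (hPQ : Approx ρ' (n + 1) P Q)
    (h₀ : ∀ x y, Head P (var x) → Head Q (var y) → ρ' x y → Approx ρ (n + 1) (σ x) (τ y)) :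
    Approx ρ (n + 1) (fsub σ P) (fsub τ Q) := by
  induction n generalizing σ τ P Q with
  | zero =>
    intro a ha
    rcases head_fsub hσ ha with ⟨x, hx, ha⟩ | ⟨p, hp, hpx, rfl⟩
    · obtain ⟨q, hq, hpq⟩ := hPQ _ hx
      cases hpq with
      | @var _ y hxy =>
        obtain ⟨b, hb, hab⟩ := h₀ x y hx hq hxy a ha
        exact ⟨b, Head.fsub_var hτ hq hb, hab⟩
    · obtain ⟨q, hq, hpq⟩ := hPQ _ hp
      refine ⟨fsub τ q, (hq.fsub hτ).resolve_left ?_, ?_⟩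
      · rintro ⟨y, rfl⟩
        cases hpq
        exact hpx _ rfl
      · cases hpq with
        | var _ => exact (hpx _ rfl).elim
        | const c => exact .const c
        | comp _ _ => exact .comp trivial trivial
        | arrow _ _ => exact .arrow trivial trivial
  | succ n ih =>
    intro a ha
    rcases head_fsub hσ ha with ⟨x, hx, ha⟩ | ⟨p, hp, hpx, rfl⟩
    · obtain ⟨q, hq, hpq⟩ := hPQ _ hx
      cases hpq with
      | @var _ y hxy =>
        obtain ⟨b, hb, hab⟩ := h₀ x y hx hq hxy a ha
        exact ⟨b, Head.fsub_var hτ hq hb, hab⟩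
    · obtain ⟨q, hq, hpq⟩ := hPQ _ hp
      have ih₁ : ∀ {P Q}, Approx ρ' (n + 1) P Q → Approx ρ (n + 1) (fsub σ P) (fsub τ Q) :=
        fun hPQ => ih hσ hτ (fun x y h => (h₁ x y h).of_succ) (fun x y h => (h₂ x y h).of_succ)
          hPQ fun x y _ _ h => h₁ x y h
      -- The domains of arrows are contravariant, so the two substitutions change places; this is
      -- why both `h₁` and `h₂` are assumed.
      have ih₂ : ∀ {P Q}, Approx ρ' (n + 1) P Q → Approx ρ (n + 1) (fsub τ P) (fsub σ Q) :=
        fun hPQ => ih hτ hσ (fun x y h => (h₂ x y h).of_succ) (fun x y h => (h₁ x y h).of_succ)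
          hPQ fun x y _ _ h => h₂ x y h
      refine ⟨fsub τ q, (hq.fsub hτ).resolve_left ?_, ?_⟩
      · rintro ⟨y, rfl⟩
        cases hpq
        exact hpx _ rfl
      · cases hpq with
        | var _ => exact (hpx _ rfl).elim
        | const c => exact .const c
        | comp h h' => exact .comp (ih₁ h) (ih₁ h')
        | arrow h h' => exact .arrow (ih₂ h) (ih₁ h')

theorem Approx.of_mu (hρ : ∀ x, ρ x x) (k : Kind) (n : ℕ) (A : PreType DV TV C) :
    Approx ρ n (mu k A) (A.inst (mu k A)) :=
  Approx.of_head hρ n fun _ => head_mu.1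

theorem Approx.to_mu (hρ : ∀ x, ρ x x) (k : Kind) (n : ℕ) (A : PreType DV TV C) :
    Approx ρ n (A.inst (mu k A)) (mu k A) :=
  Approx.of_head hρ n fun _ => head_mu.2

/-- Instantiating two equivalent guarded bodies with equivalent expressions. -/
theorem Approx.inst_succ {V : Var DV TV} {a b : PreType DV TV C} (ha : LC 0 a) (hb : LC 0 b)
    (hVA : V ∉ A.fv) (hVB : V ∉ B.fv) (hA : GuardedAt 0 A)
    (h : Approx Eq (n + 1) (A.inst (var V)) (B.inst (var V)))
    (hab : Approx Eq n a b) (hba : Approx Eq n b a) :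
    Approx Eq (n + 1) (A.inst a) (B.inst b) := by
  rw [← fsub_single_inst hVA ha, ← fsub_single_inst hVB hb]
  refine Approx.fsub_succ (single_lc ha V) (single_lc hb V) ?_ ?_ h ?_
  · rintro x _ rfl
    by_cases hx : x = V
    · rwa [hx, single_self, single_self]
    · rw [single_of_ne hx, single_of_ne hx]; exact Approx.refl (fun _ => rfl) _ _
  · rintro x _ rfl
    by_cases hx : x = V
    · rwa [hx, single_self, single_self]
    · rw [single_of_ne hx, single_of_ne hx]; exact Approx.refl (fun _ => rfl) _ _
  · rintro x _ hx - rfl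
    -- By guardedness `V` is not a head, so `a` and `b` are only compared below `⊃` or `@`. This is
    -- where one level is gained.
    have hx := (GuardedAt.notExposed hA hVA).ne_of_head hx
    rw [single_of_ne hx, single_of_ne hx]; exact Approx.refl (fun _ => rfl) _ _

theorem finite_fv (A : PreType DV TV C) : A.fv.Finite := by
  induction A with
  | bvar j => exact Set.finite_empty
  | var V => exact Set.finite_singleton V
  | const c => exact Set.finite_empty
  | comp D A ihD ihA => exact ihD.union ihA
  | arrow A B ihA ihB => exact ihA.union ihB
  | union A B ihA ihB => exact ihA.union ihB
  | mu k A ih => exact ih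

theorem exists_fresh [Infinite DV] [Infinite TV] {s : Set (Var DV TV)} (hs : s.Finite) (k : Kind) :
    ∃ V : Var DV TV, V.kind = k ∧ V ∉ s := by
  cases k with
  | data =>
    obtain ⟨x, hx⟩ := (hs.preimage (Sum.inl_injective.injOn (s := Sum.inl ⁻¹' s))).exists_notMem
    exact ⟨.inl x, rfl, hx⟩
  | typ =>
    obtain ⟨x, hx⟩ := (hs.preimage (Sum.inr_injective.injOn (s := Sum.inr ⁻¹' s))).exists_notMem
    exact ⟨.inr x, rfl, hx⟩

/-- Both directions are proved together because of symmetry and the contravariance of `⊃`. -/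
theorem TyEq.approx [Infinite DV] [Infinite TV] (h : TyEq A B) (n : ℕ) :
    Approx Eq n A B ∧ Approx Eq n B A := by
  have hr : ∀ x : Var DV TV, x = x := fun _ => rfl
  have ht : ∀ x y z : Var DV TV, x = y → y = z → x = z := fun _ _ _ => Eq.trans
  induction h generalizing n with
  | refl hA => exact ⟨Approx.refl hr _ _, Approx.refl hr _ _⟩
  | trans _ _ ih₁ ih₂ => exact ⟨(ih₁ n).1.trans ht (ih₂ n).1, (ih₂ n).2.trans ht (ih₁ n).2⟩
  | symm _ ih => exact (ih n).symm
  | comp _ _ _ _ ih₁ ih₂ => exact ⟨(ih₁ n).1.comp (ih₂ n).1, (ih₁ n).2.comp (ih₂ n).2⟩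
  | arrow _ _ ih₁ ih₂ => exact ⟨(ih₁ n).2.arrow (ih₂ n).1, (ih₁ n).1.arrow (ih₂ n).2⟩
  | union_idem hA =>
    exact ⟨Approx.of_head hr n fun a ha => (head_union.1 ha).elim id id,
      Approx.of_head hr n fun a ha => .union_l ha⟩
  | union_comm hA hB =>
    exact ⟨Approx.of_head hr n fun a => by simp only [head_union]; tauto,
      Approx.of_head hr n fun a => by simp only [head_union]; tauto⟩
  | union_assoc hA hB hE =>
    exact ⟨Approx.of_head hr n fun a => by simp only [head_union]; tauto,
      Approx.of_head hr n fun a => by simp only [head_union]; tauto⟩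
  | union _ _ ih₁ ih₂ =>
    exact ⟨(ih₁ n).1.union_r1.union_l (ih₂ n).1.union_r2,
      (ih₁ n).2.union_r1.union_l (ih₂ n).2.union_r2⟩
  | @mu k V A B hV hA hB hVA hVB _ ih =>
    -- Agreement of the two recursive types at level `n` is fed into their bodies, which gives
    -- agreement of the unfoldings at level `n + 1`.
    induction n with
    | zero => exact ⟨trivial, trivial⟩
    | succ n ihn =>
      exact ⟨((Approx.of_mu hr k _ A).trans ht (Approx.inst_succ hA.lc hB.lc hVA hVB hA.2.1
          (ih _).1 ihn.1 ihn.2)).trans ht (Approx.to_mu hr k _ B),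
        ((Approx.of_mu hr k _ B).trans ht (Approx.inst_succ hB.lc hA.lc hVB hVA hB.2.1
          (ih _).2 ihn.2 ihn.1)).trans ht (Approx.to_mu hr k _ A)⟩
  | @fold k A hA => exact ⟨Approx.of_mu hr k n A, Approx.to_mu hr k n A⟩
  | @contr k A B hA hB _ ih =>
    obtain ⟨V, -, hV⟩ := exists_fresh B.finite_fv k
    -- Uniqueness of fixed points: `A` and `μV.B` are both fixed by the guarded operation `B{·/V}`,
    -- so agreement at level `n` improves to level `n + 1`.
    induction n with
    | zero => exact ⟨trivial, trivial⟩
    | succ n ihn =>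
      exact ⟨((ih _).1.trans ht (Approx.inst_succ hA.lc hB.lc hV hV hB.2.1
          (Approx.refl hr _ _) ihn.1 ihn.2)).trans ht (Approx.to_mu hr k _ B),
        (Approx.of_mu hr k _ B).trans ht ((Approx.inst_succ hB.lc hA.lc hV hV hB.2.1
          (Approx.refl hr _ _) ihn.2 ihn.1).trans ht (ih _).2)⟩

/-- The preorder on variables generated by a set of assumptions. -/
def CtxRel (S : Set (Var DV TV × Var DV TV)) : Var DV TV → Var DV TV → Prop :=
  Relation.ReflTransGen fun x y => (x, y) ∈ S

variable {S : Set (Var DV TV × Var DV TV)} {V W x y : Var DV TV}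

theorem CtxRel.refl (S : Set (Var DV TV × Var DV TV)) (x : Var DV TV) : CtxRel S x x :=
  Relation.ReflTransGen.refl

theorem CtxRel.trans {z : Var DV TV} (h₁ : CtxRel S x y) (h₂ : CtxRel S y z) : CtxRel S x z :=
  Relation.ReflTransGen.trans h₁ h₂

/-- A chain of positive length starts and ends at variables that occur in `S`. -/
theorem CtxRel.eq_or_ne (h : CtxRel S x y) (hV : NotInCtx V S) : x = y ∨ x ≠ V ∧ y ≠ V := by
  rcases Relation.ReflTransGen.cases_head h with rfl | ⟨z, hz, -⟩
  · exact .inl rfl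
  rcases Relation.ReflTransGen.cases_tail h with rfl | ⟨w, -, hw⟩
  · exact .inl rfl
  exact .inr ⟨(hV _ hz).1, (hV _ hw).2⟩

/-- Since `V` and `W` do not occur in `S`, the new assumption cannot be composed with old ones and
adds just one pair. -/
theorem CtxRel.of_insert (hV : NotInCtx V S) (hW : NotInCtx W S)
    (h : CtxRel (insert (V, W) S) x y) : x = V ∧ y = W ∨ CtxRel S x y := by
  induction h with
  | refl => exact .inr (.refl S x)
  | @tail y z _ hyz ih =>
    rcases hyz with hyz | hyz
    · cases hyz
      rcases ih with ⟨rfl, rfl⟩ | h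
      · exact .inl ⟨rfl, rfl⟩
      · rcases h.eq_or_ne hV with rfl | h'
        · exact .inl ⟨rfl, rfl⟩
        · exact (h'.2 rfl).elim
    · rcases ih with ⟨rfl, rfl⟩ | h
      · exact ((hW _ hyz).1 rfl).elim
      · exact .inr (h.tail hyz)

/-- Variables are compared by the preorder generated by the assumptions, since derivations may chain
assumptions by transitivity. -/
theorem StrongSub.approx [Infinite DV] [Infinite TV] (h : StrongSub S A B) (n : ℕ) :
    Approx (CtxRel S) n A B := by
  induction h generalizing n with
  | refl hA => exact Approx.refl (CtxRel.refl _) _ _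
  | hyp h =>
    cases n with
    | zero => trivial
    | succ n =>
      intro a ha
      cases ha
      exact ⟨_, .var _, .var (.single h)⟩
  | @eq S A B h =>
    refine (h.approx n).1.mono_var ?_
    rintro x _ rfl
    exact CtxRel.refl S x
  | trans _ _ ih₁ ih₂ => exact (ih₁ n).trans (fun _ _ _ => CtxRel.trans) (ih₂ n)
  | comp _ _ _ _ ih₁ ih₂ => exact (ih₁ n).comp (ih₂ n)
  | arrow _ _ ih₁ ih₂ => exact (ih₁ n).arrow (ih₂ n)
  | union_l _ _ ih₁ ih₂ => exact (ih₁ n).union_l (ih₂ n)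
  | union_r1 _ _ ih => exact (ih n).union_r1
  | union_r2 _ _ ih => exact (ih n).union_r2
  | @mu S k l V W A B hV hW hA hB hVA hWB hVS hWS hWA hVB _ ih =>
    have hr := CtxRel.refl S
    have ht : ∀ x y z, CtxRel S x y → CtxRel S y z → CtxRel S x z := fun _ _ _ => CtxRel.trans
    induction n with
    | zero => trivial
    | succ n ihn =>
      refine ((Approx.of_mu hr k _ A).trans ht ?_).trans ht (Approx.to_mu hr l _ B)
      classical
      -- One substitution unfolds both bodies. The value at `V` takes precedence, but if `V = W`,
      -- then `hWA` and `hVB` keep this variable out of both bodies.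
      let σ : Var DV TV → PreType DV TV C :=
        Function.update (single W (PreType.mu l B)) V (PreType.mu k A)
      have hσV : σ V = PreType.mu k A := by simp [σ]
      have hσ : ∀ x, x ≠ V → σ x = single W (PreType.mu l B) x := fun x hx => by simp [σ, hx]
      have hσ' : ∀ x, x ≠ V → x ≠ W → σ x = PreType.var x := fun x hx hx' => by
        rw [hσ x hx, single_of_ne hx']
      have hlc : ∀ x, LC 0 (σ x) := fun x => by
        by_cases hx : x = V
        · rw [hx, hσV]; exact hA.lc
        · rw [hσ x hx]; exact single_lc hB.lc W x
      have eA : fsub σ (A.inst (PreType.var V)) = A.inst (PreType.mu k A) := by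
        rw [← fsub_single_inst hVA hA.lc]
        refine fsub_congr fun x hx => ?_
        by_cases hx' : x = V
        · rw [hx', hσV, single_self]
        · rw [hσ' x hx' fun h => hWA (h ▸ hx), single_of_ne hx']
      have eB : fsub σ (B.inst (PreType.var W)) = B.inst (PreType.mu l B) := by
        rw [← fsub_single_inst hWB hB.lc]
        exact fsub_congr fun x hx => hσ x fun h => hVB (h ▸ hx)
      -- The assumption `V ⪯ W` turns into the inductive hypothesis `ihn` at level `n`; all other
      -- related variables are equal or left unchanged by `σ`.
      have hrel : ∀ x y, CtxRel (insert (V, W) S) x y → Approx (CtxRel S) n (σ x) (σ y) := by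
        intro x y hxy
        rcases hxy.of_insert hVS hWS with ⟨rfl, rfl⟩ | hxy
        · by_cases hxy : x = y
          · rw [hxy]; exact Approx.refl hr _ _
          · rwa [hσV, hσ y (Ne.symm hxy), single_self]
        · rcases hxy.eq_or_ne hVS with rfl | hx
          · exact Approx.refl hr _ _
          rcases hxy.eq_or_ne hWS with rfl | hy
          · exact Approx.refl hr _ _
          rw [hσ' x hx.1 hy.1, hσ' y hx.2 hy.2]
          cases n with
          | zero => trivial
          | succ n =>
            intro a ha
            cases ha
            exact ⟨_, .var _, .var hxy⟩
      rw [← eA, ← eB]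
      refine Approx.fsub_succ hlc hlc hrel hrel (ih _) fun x y hx hy hxy => ?_
      -- At level `n + 1` only heads matter, and neither `V` nor `W` is a head of either body: one
      -- by guardedness, the other by the side conditions of the rule.
      have hxV := (GuardedAt.notExposed hA.2.1 hVA).ne_of_head hx
      have hxW := (notExposed_of_not_mem_fv hWA).ne_of_head hx
      have hyW := (GuardedAt.notExposed hB.2.1 hWB).ne_of_head hy
      have hyV := (notExposed_of_not_mem_fv hVB).ne_of_head hy
      rw [hσ' x hxV hxW, hσ' y hyV hyW]
      intro a ha
      cases ha
      exact ⟨_, .var _, .var ((hxy.of_insert hVS hWS).resolve_left fun h => hxV h.1)⟩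

theorem StrongSub.coSub [Infinite DV] [Infinite TV] (hA : IsMuType A) (hB : IsMuType B)
    (h : StrongSub ∅ A B) : CoSub A B := by
  refine coSub_of_approx hA hB fun n => (h.approx n).mono_var fun x y hxy => ?_
  rcases Relation.ReflTransGen.cases_head hxy with h | ⟨_, h, -⟩
  exacts [h, h.elim]

/-! ### The finitely many expressions reachable from a given one -/

theorem lc_bsub {σ : ℕ → PreType DV TV C} (hσ : ∀ i, LC 0 (σ i)) (d : ℕ)
    (A : PreType DV TV C) : LC d (bsub σ d A) := by
  induction A generalizing d with
  | bvar j =>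
    simp only [bsub]
    split_ifs with h
    exacts [h, (hσ _).mono (Nat.zero_le d)]
  | var V => trivial
  | const c => trivial
  | comp D A ihD ihA => exact ⟨ihD d, ihA d⟩
  | arrow A B ihA ihB => exact ⟨ihA d, ihB d⟩
  | union A B ihA ihB => exact ⟨ihA d, ihB d⟩
  | mu k A ih => exact ih (d + 1)

/-- Passing to an immediate subexpression, respectively to the unfolding. -/
inductive Step : PreType DV TV C → PreType DV TV C → Prop
  | comp_l (D A : PreType DV TV C) : Step (comp D A) D
  | comp_r (D A : PreType DV TV C) : Step (comp D A) A
  | arrow_l (A B : PreType DV TV C) : Step (arrow A B) A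
  | arrow_r (A B : PreType DV TV C) : Step (arrow A B) B
  | union_l (A B : PreType DV TV C) : Step (union A B) A
  | union_r (A B : PreType DV TV C) : Step (union A B) B
  | mu (k : Kind) (A : PreType DV TV C) : Step (mu k A) (A.inst (mu k A))

/-- The closed instances of the subexpressions, where a binder is instantiated by the recursive
expression that it belongs to, and the dangling indices by `σ`. -/
def reach : (ℕ → PreType DV TV C) → PreType DV TV C → Set (PreType DV TV C)
  | σ, bvar i => {σ i}
  | _, var V => {var V}
  | _, const c => {const c}
  | σ, comp D A => insert (bsub σ 0 (comp D A)) (reach σ D ∪ reach σ A)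
  | σ, arrow A B => insert (bsub σ 0 (arrow A B)) (reach σ A ∪ reach σ B)
  | σ, union A B => insert (bsub σ 0 (union A B)) (reach σ A ∪ reach σ B)
  | σ, mu k A => insert (bsub σ 0 (mu k A)) (reach (consEnv (bsub σ 0 (mu k A)) σ) A)

theorem finite_reach (σ : ℕ → PreType DV TV C) (A : PreType DV TV C) : (reach σ A).Finite := by
  induction A generalizing σ with
  | comp D A ihD ihA => exact ((ihD σ).union (ihA σ)).insert _
  | arrow A B ihA ihB => exact ((ihA σ).union (ihB σ)).insert _
  | union A B ihA ihB => exact ((ihA σ).union (ihB σ)).insert _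
  | mu k A ih => exact (ih _).insert _
  | _ => exact Set.finite_singleton _

theorem bsub_mem_reach (σ : ℕ → PreType DV TV C) (A : PreType DV TV C) :
    bsub σ 0 A ∈ reach σ A := by
  cases A with
  | bvar i => simp [bsub, reach]
  | var V => exact rfl
  | const c => exact rfl
  | comp D A => exact .inl rfl
  | arrow A B => exact .inl rfl
  | union A B => exact .inl rfl
  | mu k A => exact .inl rfl

/-- Unfolding an instantiated binder gives its body under the extended environment, which `reach`
already contains. The superset `T` lets the induction enter a binder while steps from environment
entries lead outside the body's own reachable set. -/
theorem Step.mem_of_mem_reach {σ : ℕ → PreType DV TV C} (hσ : ∀ i, LC 0 (σ i))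
    {T : Set (PreType DV TV C)} (hT : ∀ i t, Step (σ i) t → t ∈ T) {A : PreType DV TV C}
    (hA : reach σ A ⊆ T) {s t : PreType DV TV C} (hs : s ∈ reach σ A) (hst : Step s t) :
    t ∈ T := by
  induction A generalizing σ with
  | bvar i => cases hs; exact hT i t hst
  | var V => cases hs; cases hst
  | const c => cases hs; cases hst
  | comp D A ihD ihA =>
    rcases hs with rfl | hs | hs
    · cases hst
      exacts [hA (.inr (.inl (bsub_mem_reach σ _))), hA (.inr (.inr (bsub_mem_reach σ _)))]
    · exact ihD hσ hT (fun x hx => hA (.inr (.inl hx))) hs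
    · exact ihA hσ hT (fun x hx => hA (.inr (.inr hx))) hs
  | arrow A B ihA ihB =>
    rcases hs with rfl | hs | hs
    · cases hst
      exacts [hA (.inr (.inl (bsub_mem_reach σ _))), hA (.inr (.inr (bsub_mem_reach σ _)))]
    · exact ihA hσ hT (fun x hx => hA (.inr (.inl hx))) hs
    · exact ihB hσ hT (fun x hx => hA (.inr (.inr hx))) hs
  | union A B ihA ihB =>
    rcases hs with rfl | hs | hs
    · cases hst
      exacts [hA (.inr (.inl (bsub_mem_reach σ _))), hA (.inr (.inr (bsub_mem_reach σ _)))]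
    · exact ihA hσ hT (fun x hx => hA (.inr (.inl hx))) hs
    · exact ihB hσ hT (fun x hx => hA (.inr (.inr hx))) hs
  | mu k A ih =>
    have hmu : ∀ t, Step (bsub σ 0 (PreType.mu k A)) t → t ∈ T := fun t ht => by
      cases ht
      refine hA (.inr ?_)
      have := bsub_mem_reach (consEnv (bsub σ 0 (PreType.mu k A)) σ) A
      rwa [← inst_bsub hσ] at this
    rcases hs with rfl | hs
    · exact hmu t hst
    · refine ih (σ := consEnv (bsub σ 0 (PreType.mu k A)) σ) ?_ ?_
        (fun x hx => hA (.inr hx)) hs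
      · rintro (_ | i)
        exacts [lc_bsub hσ 0 _, hσ i]
      · rintro (_ | i)
        exacts [hmu, hT i]

theorem LC.exists_finite_closed [Nonempty (Var DV TV)] {A : PreType DV TV C} (hA : LC 0 A) :
    ∃ U : Set (PreType DV TV C), U.Finite ∧ A ∈ U ∧ ∀ s ∈ U, ∀ t, Step s t → t ∈ U := by
  obtain ⟨V⟩ := ‹Nonempty (Var DV TV)›
  -- Any variable serves as the default value: it has no steps, and no dangling index of `A` ever
  -- reads it.
  refine ⟨reach (fun _ => var V) A, finite_reach _ A, ?_, fun s hs t hst => ?_⟩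
  · have := bsub_mem_reach (fun _ => var V) A
    rwa [hA.bsub_eq le_rfl] at this
  · refine Step.mem_of_mem_reach (fun _ => ?_) (fun i t h => ?_) subset_rfl hs hst
    · trivial
    · cases h

theorem Head.mem_of_closed {U : Set (PreType DV TV C)} (hU : ∀ s ∈ U, ∀ t, Step s t → t ∈ U)
    {A h : PreType DV TV C} (hh : Head A h) (hA : A ∈ U) : h ∈ U := by
  induction hh with
  | union_l _ ih => exact ih (hU _ hA _ (.union_l _ _))
  | union_r _ ih => exact ih (hU _ hA _ (.union_r _ _))
  | mu _ ih => exact ih (hU _ hA _ (.mu _ _))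
  | _ => exact hA

/-! ### Equivalences of unions -/

theorem TyEq.isMuType_left_right {A B : PreType DV TV C} (h : TyEq A B) :
    IsMuType A ∧ IsMuType B := by
  have hu : ∀ {A B : PreType DV TV C}, IsMuType A → IsMuType B → IsMuType (PreType.union A B) :=
    fun hA hB => ⟨.union hA.1 hB.1, hA.2, hB.2⟩
  induction h with
  | refl hA => exact ⟨hA, hA⟩
  | trans _ _ ih₁ ih₂ => exact ⟨ih₁.1, ih₂.2⟩
  | symm _ ih => exact ih.symm
  | comp hD hD' _ _ ih₁ ih₂ =>
    exact ⟨⟨.ofData (.comp hD.1 ih₂.1.1), hD.2, ih₂.1.2⟩,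
      ⟨.ofData (.comp hD'.1 ih₂.2.1), hD'.2, ih₂.2.2⟩⟩
  | arrow _ _ ih₁ ih₂ =>
    exact ⟨⟨.arrow ih₁.1.1 ih₂.1.1, ih₁.1.2, ih₂.1.2⟩, ⟨.arrow ih₁.2.1 ih₂.2.1, ih₁.2.2, ih₂.2.2⟩⟩
  | union_idem hA => exact ⟨hu hA hA, hA⟩
  | union_comm hA hB => exact ⟨hu hA hB, hu hB hA⟩
  | union_assoc hA hB hE => exact ⟨hu hA (hu hB hE), hu (hu hA hB) hE⟩
  | union _ _ ih₁ ih₂ => exact ⟨hu ih₁.1 ih₂.1, hu ih₁.2 ih₂.2⟩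
  | mu _ hA hB => exact ⟨hA, hB⟩
  | fold hA => exact ⟨hA, hA.unfold⟩
  | contr hA hB => exact ⟨hA.isMuType, hB⟩

/-- Equivalent expressions are absorbed by the same unions. -/
theorem TyEq.absorb_congr {a b B : PreType DV TV C} (hab : TyEq a b)
    (h : TyEq (PreType.union b B) B) : TyEq (PreType.union a B) B :=
  .trans (.union hab (.refl h.isMuType_left_right.2)) h

theorem TyEq.absorb_union {a b B : PreType DV TV C} (ha : IsMuType a) (hb : IsMuType b)
    (hB : IsMuType B) (h₁ : TyEq (PreType.union a B) B) (h₂ : TyEq (PreType.union b B) B) :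
    TyEq (PreType.union (PreType.union a b) B) B :=
  .trans (.symm (.union_assoc ha hb hB)) (.trans (.union (.refl ha) h₂) h₁)

/-- Idempotence absorbs the head at the place where it occurs; associativity, commutativity and
unfolding carry this up to the root. -/
theorem Head.tyEq_absorb {A h : PreType DV TV C} (hh : Head A h) (hA : IsMuType A) :
    TyEq (PreType.union h A) A := by
  induction hh with
  | @union_l A B h hh ih =>
    have hA' := hA.union_inv
    exact .trans (.union_assoc (hh.isOfKind hA'.1) hA'.1 hA'.2) (.union (ih hA'.1) (.refl hA'.2))
  | @union_r A B h hh ih =>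
    have hA' := hA.union_inv
    have hc := TyEq.union_comm hA'.1 hA'.2
    have hh' := hh.isOfKind hA'.2
    exact .trans (.union (.refl hh') hc) (.trans (.union_assoc hh' hA'.2 hA'.1)
      (.trans (.union (ih hA'.2) (.refl hA'.1)) hc.symm))
  | @mu k A h hh ih =>
    have hf := TyEq.fold hA
    exact .trans (.union (.refl (hh.isOfKind hA.unfold)) hf) (.trans (ih hA.unfold) hf.symm)
  | _ => exact .union_idem hA

/-! ### Contexts of simultaneous recursive definitions -/

/-- One of the two recursive types introduced for a pair of types `A ⪯ B`: its sort, the one of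
the two types that it is meant to be equivalent to, and the name of its bound variable. -/
structure Side (DV TV C : Type*) where
  kind : Kind
  val : PreType DV TV C
  name : Var DV TV

/-- The two recursive types introduced for a pair of types. If `co` holds then the left one is
assumed to be a subtype of the right one, otherwise the other way round. -/
structure Hyp (DV TV C : Type*) where
  left : Side DV TV C
  right : Side DV TV C
  co : Bool

/-- Exchange of the two sides. -/
def Hyp.flip (e : Hyp DV TV C) : Hyp DV TV C := ⟨e.right, e.left, !e.co⟩

/-- The assumption between the names. -/
def Hyp.assumption (e : Hyp DV TV C) : Var DV TV × Var DV TV :=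
  if e.co then (e.left.name, e.right.name) else (e.right.name, e.left.name)

/-- All assumptions between the names. -/
def assumptions (Γ : List (Hyp DV TV C)) : Set (Var DV TV × Var DV TV) :=
  {p | ∃ e ∈ Γ, e.assumption = p}

/-- The environment of intended values. -/
def vals (c : C) (l : List (Side DV TV C)) (i : ℕ) : PreType DV TV C :=
  (l[i]?).elim (const c) Side.val

/-- The environment of names. -/
def names (c : C) (l : List (Side DV TV C)) (i : ℕ) : PreType DV TV C :=
  (l[i]?).elim (const c) fun s => var s.name

/-- The intended value and the name have the given sort. -/
def Side.Valid (s : Side DV TV C) : Prop := IsOfKind s.kind s.val ∧ s.name.kind = s.kind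

theorem vals_cons (c : C) (s : Side DV TV C) (l : List (Side DV TV C)) :
    vals c (s :: l) = consEnv s.val (vals c l) := by
  funext i; cases i <;> rfl

theorem names_cons (c : C) (s : Side DV TV C) (l : List (Side DV TV C)) :
    names c (s :: l) = consEnv (var s.name) (names c l) := by
  funext i; cases i <;> rfl

theorem vals_cases (c : C) (l : List (Side DV TV C)) (i : ℕ) :
    vals c l i = const c ∨ ∃ s ∈ l, l[i]? = some s ∧ vals c l i = s.val := by
  rcases h : l[i]? with _ | s
  · exact .inl (by simp [vals, h])
  · exact .inr ⟨s, List.mem_of_getElem? h, rfl, by simp [vals, h]⟩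

theorem names_cases (c : C) (l : List (Side DV TV C)) (i : ℕ) :
    names c l i = const c ∨ ∃ s ∈ l, l[i]? = some s ∧ names c l i = var s.name := by
  rcases h : l[i]? with _ | s
  · exact .inl (by simp [names, h])
  · exact .inr ⟨s, List.mem_of_getElem? h, rfl, by simp [names, h]⟩

theorem mem_fv_names {c : C} {l : List (Side DV TV C)} {i : ℕ} {V : Var DV TV}
    (h : V ∈ (names c l i).fv) : ∃ s ∈ l, s.name = V := by
  rcases names_cases c l i with h' | ⟨s, hs, -, h'⟩
  · rw [h'] at h; exact h.elim
  · rw [h'] at h; exact ⟨s, hs, h.symm⟩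

/-- Contractive expressions of sort `k` whose dangling indices refer to `l` and whose free
variables are in `F`. -/
structure IsBody (F : Set (Var DV TV)) (l : List (Side DV TV C)) (k : Kind)
    (L : PreType DV TV C) : Prop where
  sorted : WellSorted (l.map Side.kind) k L
  contractive : L.Contractive
  fv_subset : L.fv ⊆ F

section IsBody

variable {F : Set (Var DV TV)} {l : List (Side DV TV C)} {k : Kind} {L : PreType DV TV C}

theorem lc_vals (c : C) (hl : ∀ s ∈ l, s.Valid) (i : ℕ) : LC 0 (vals c l i) := by
  rcases vals_cases c l i with h | ⟨s, hs, -, h⟩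
  · rw [h]; trivial
  · rw [h]; exact (hl s hs).1.lc

theorem lc_names (c : C) (l : List (Side DV TV C)) (i : ℕ) : LC 0 (names c l i) := by
  rcases names_cases c l i with h | ⟨s, hs, -, h⟩ <;> rw [h] <;> trivial

theorem IsBody.isOfKind_vals (hL : IsBody F l k L) (c : C) (hl : ∀ s ∈ l, s.Valid) :
    IsOfKind k (bsub (vals c l) 0 L) := by
  refine ⟨WellSorted.bsub (Δ := []) (Γ := l.map Side.kind) (fun i k hk => ?_) hL.sorted,
    Contractive.bsub (lc_vals c hl) (fun i => ?_) hL.contractive⟩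
  · rcases vals_cases c l i with h | ⟨s, hs, hi, h⟩
    · simp only [List.getElem?_map, Option.map_eq_some_iff] at hk
      obtain ⟨s, hs, rfl⟩ := hk
      simp only [vals, hs, Option.elim]
      exact (hl s (List.mem_of_getElem? hs)).1.1
    · rw [h]
      simp only [List.getElem?_map, hi, Option.map_some, Option.some.injEq] at hk
      exact hk ▸ (hl s hs).1.1
  · rcases vals_cases c l i with h | ⟨s, hs, -, h⟩
    · rw [h]; trivial
    · rw [h]; exact (hl s hs).1.2

theorem IsBody.isOfKind_names (hL : IsBody F l k L) (c : C) (hl : ∀ s ∈ l, s.Valid) :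
    IsOfKind k (bsub (names c l) 0 L) := by
  refine ⟨WellSorted.bsub (Δ := []) (Γ := l.map Side.kind) (fun i k hk => ?_) hL.sorted,
    Contractive.bsub (lc_names c l) (fun i => ?_) hL.contractive⟩
  · simp only [List.getElem?_map, Option.map_eq_some_iff] at hk
    obtain ⟨s, hs, rfl⟩ := hk
    simp only [names, hs, Option.elim]
    exact .var _ (hl s (List.mem_of_getElem? hs)).2
  · rcases names_cases c l i with h | ⟨s, hs, -, h⟩ <;> rw [h] <;> trivial

theorem IsBody.union {L' : PreType DV TV C} (hL : IsBody F l k L) (hL' : IsBody F l k L') :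
    IsBody F l k (PreType.union L L') :=
  ⟨.union hL.sorted hL'.sorted, ⟨hL.contractive, hL'.contractive⟩,
    Set.union_subset hL.fv_subset hL'.fv_subset⟩

theorem IsBody.comp {L' : PreType DV TV C} (hL : IsBody F l .data L) (hL' : IsBody F l .typ L') :
    IsBody F l k (PreType.comp L L') :=
  ⟨(WellSorted.comp hL.sorted hL'.sorted).of_data k, ⟨hL.contractive, hL'.contractive⟩,
    Set.union_subset hL.fv_subset hL'.fv_subset⟩

theorem IsBody.arrow {L' : PreType DV TV C} (hL : IsBody F l .typ L) (hL' : IsBody F l .typ L') :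
    IsBody F l .typ (PreType.arrow L L') :=
  ⟨.arrow hL.sorted hL'.sorted, ⟨hL.contractive, hL'.contractive⟩,
    Set.union_subset hL.fv_subset hL'.fv_subset⟩

theorem IsBody.mu {s : Side DV TV C} (hL : IsBody F (s :: l) s.kind L) (hg : GuardedAt 0 L) :
    IsBody F l s.kind (PreType.mu s.kind L) :=
  ⟨.mu hL.sorted, ⟨hg, hL.contractive⟩, hL.fv_subset⟩

theorem IsOfKind.isBody (hL : IsOfKind k L) (hF : L.fv ⊆ F) (l : List (Side DV TV C)) :
    IsBody F l k L :=
  ⟨hL.1.weaken _, hL.2, hF⟩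

end IsBody

/-- For the pair `A`, `B` there are a left and a right expression over the context `Γ` that are
equivalent to `A` and `B` under the intended values, and in the subtype relation under the
assumptions of `Γ`. -/
def Solvable (c : C) (F : Set (Var DV TV)) (Γ : List (Hyp DV TV C)) (k l : Kind)
    (A B : PreType DV TV C) : Prop :=
  ∃ L R, IsBody F (Γ.map Hyp.left) k L ∧ IsBody F (Γ.map Hyp.right) l R ∧
    TyEq (bsub (vals c (Γ.map Hyp.left)) 0 L) A ∧
    TyEq (bsub (vals c (Γ.map Hyp.right)) 0 R) B ∧
    StrongSub (assumptions Γ) (bsub (names c (Γ.map Hyp.left)) 0 L)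
      (bsub (names c (Γ.map Hyp.right)) 0 R)

theorem map_left_flip (Γ : List (Hyp DV TV C)) :
    (Γ.map Hyp.flip).map Hyp.left = Γ.map Hyp.right := by
  rw [List.map_map]; rfl

theorem map_right_flip (Γ : List (Hyp DV TV C)) :
    (Γ.map Hyp.flip).map Hyp.right = Γ.map Hyp.left := by
  rw [List.map_map]; rfl

theorem Hyp.assumption_flip (e : Hyp DV TV C) : e.flip.assumption = e.assumption := by
  rcases e with ⟨_, _, _ | _⟩ <;> rfl

theorem assumptions_flip (Γ : List (Hyp DV TV C)) :
    assumptions (Γ.map Hyp.flip) = assumptions Γ := by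
  ext p
  simp [assumptions, Hyp.assumption_flip]

theorem assumptions_cons (e : Hyp DV TV C) (Γ : List (Hyp DV TV C)) :
    assumptions (e :: Γ) = insert e.assumption (assumptions Γ) := by
  ext p
  simp [assumptions, eq_comm]

/-- The pair of types, with sorts and direction, for which an entry has been made. -/
def Hyp.key (e : Hyp DV TV C) : Bool × (Kind × PreType DV TV C) × (Kind × PreType DV TV C) :=
  (e.co, (e.left.kind, e.left.val), (e.right.kind, e.right.val))

/-- All entries relate expressions in `U`, of the declared sorts. -/
def ValidCtx (U : Set (PreType DV TV C)) (Γ : List (Hyp DV TV C)) : Prop :=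
  ∀ e ∈ Γ, (e.left.Valid ∧ e.left.val ∈ U) ∧ e.right.Valid ∧ e.right.val ∈ U

/-! ### Completeness: construction of strong subtyping derivations -/

section Completeness

variable {U : Set (PreType DV TV C)} {Γ : List (Hyp DV TV C)} {F : Set (Var DV TV)}
  {k l : Kind} {A B : PreType DV TV C} {c : C}

theorem ValidCtx.flip (h : ValidCtx U Γ) : ValidCtx U (Γ.map Hyp.flip) := by
  intro e he
  obtain ⟨e', he', rfl⟩ := List.mem_map.1 he
  exact (h e' he').symm

theorem ValidCtx.left (h : ValidCtx U Γ) : ∀ s ∈ Γ.map Hyp.left, s.Valid := by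
  intro s hs
  obtain ⟨e, he, rfl⟩ := List.mem_map.1 hs
  exact (h e he).1.1

theorem ValidCtx.right (h : ValidCtx U Γ) : ∀ s ∈ Γ.map Hyp.right, s.Valid := by
  intro s hs
  obtain ⟨e, he, rfl⟩ := List.mem_map.1 hs
  exact (h e he).2.1

/-- Flipping acts on keys by an injective map. -/
theorem nodup_key_flip (h : (Γ.map Hyp.key).Nodup) :
    ((Γ.map Hyp.flip).map Hyp.key).Nodup := by
  have : (Γ.map Hyp.flip).map Hyp.key =
      (Γ.map Hyp.key).map fun p => (!p.1, p.2.2, p.2.1) := by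
    simp only [List.map_map]; rfl
  rw [this]
  refine h.map ?_
  rintro ⟨a, b, d⟩ ⟨a', b', d'⟩ hab
  simp only [Prod.mk.injEq] at hab ⊢
  exact ⟨by simpa using hab.1, hab.2.2, hab.2.1⟩

/-- The bodies of the pair of recursive expressions for `A` and `B`, provided that the pairs of
components of their heads have been dealt with. The right one may lack summands. -/
theorem exists_guarded_bodies (hU : ∀ s ∈ U, ∀ t, Step s t → t ∈ U) (hF : ∀ t ∈ U, t.fv ⊆ F)
    (hΓ : ValidCtx U Γ)
    (hs : ∀ k l A B, A ∈ U → B ∈ U → IsOfKind k A → IsOfKind l B → (∀ n, Approx Eq n A B) →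
      Solvable c F Γ k l A B)
    (hs' : ∀ k l A B, A ∈ U → B ∈ U → IsOfKind k A → IsOfKind l B → (∀ n, Approx Eq n A B) →
      Solvable c F (Γ.map Hyp.flip) k l A B)
    (hBU : B ∈ U) (hB : IsOfKind l B) (hAU : A ∈ U) (hA : IsOfKind k A)
    (hAB : ∀ n, Approx Eq n A B) :
    ∃ L R, (IsBody F (Γ.map Hyp.left) k L ∧ GuardedAt 0 L) ∧
      (IsBody F (Γ.map Hyp.right) l R ∧ GuardedAt 0 R) ∧
      TyEq (bsub (vals c (Γ.map Hyp.left)) 0 L) A ∧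
      TyEq (union (bsub (vals c (Γ.map Hyp.right)) 0 R) B) B ∧
      StrongSub (assumptions Γ) (bsub (names c (Γ.map Hyp.left)) 0 L)
        (bsub (names c (Γ.map Hyp.right)) 0 R) := by
  have hBm := hB.isMuType
  revert hAU hAB
  refine IsOfKind.head_induction (k := k) (motive := fun A => A ∈ U → (∀ n, Approx Eq n A B) →
    ∃ L R, (IsBody F (Γ.map Hyp.left) k L ∧ GuardedAt 0 L) ∧
      (IsBody F (Γ.map Hyp.right) l R ∧ GuardedAt 0 R) ∧
      TyEq (bsub (vals c (Γ.map Hyp.left)) 0 L) A ∧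
      TyEq (union (bsub (vals c (Γ.map Hyp.right)) 0 R) B) B ∧
      StrongSub (assumptions Γ) (bsub (names c (Γ.map Hyp.left)) 0 L)
        (bsub (names c (Γ.map Hyp.right)) 0 R)) ?_ ?_ ?_ ?_ ?_ ?_ hA
  · intro V hV hVU hVB
    obtain ⟨b, hb, hVb⟩ := hB.exists_headRel hVB (.var V)
    cases hVb with
    | var h =>
      cases h
      exact ⟨var V, var V, ⟨hV.isBody (hF _ hVU) _, trivial⟩,
        ⟨(hb.isOfKind hB).isBody (hF _ hVU) _, trivial⟩, .refl hV.isMuType, hb.tyEq_absorb hBm,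
        .refl hV.isMuType⟩
  · intro d hd hdU hdB
    obtain ⟨b, hb, hdb⟩ := hB.exists_headRel hdB (.const d)
    cases hdb with
    | const =>
      exact ⟨const d, const d, ⟨hd.isBody (hF _ hdU) _, trivial⟩,
        ⟨(hb.isOfKind hB).isBody (hF _ hdU) _, trivial⟩, .refl hd.isMuType, hb.tyEq_absorb hBm,
        .refl hd.isMuType⟩
  · intro D A hDA hDAU hDAB
    obtain ⟨b, hb, hab⟩ := hB.exists_headRel hDAB (.comp D A)
    cases hab with
    | @comp _ D' _ A' h₁ h₂ =>
      have hbU := hb.mem_of_closed hU hBU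
      have hbk := hb.isOfKind hB
      obtain ⟨L₁, R₁, hL₁, hR₁, eL₁, eR₁, s₁⟩ := hs .data .data D D' (hU _ hDAU _ (.comp_l _ _))
        (hU _ hbU _ (.comp_l _ _)) hDA.comp_inv.1 hbk.comp_inv.1 h₁
      obtain ⟨L₂, R₂, hL₂, hR₂, eL₂, eR₂, s₂⟩ := hs .typ .typ A A' (hU _ hDAU _ (.comp_r _ _))
        (hU _ hbU _ (.comp_r _ _)) hDA.comp_inv.2 hbk.comp_inv.2 h₂
      exact ⟨comp L₁ L₂, comp R₁ R₂, ⟨hL₁.comp hL₂, trivial⟩, ⟨hR₁.comp hR₂, trivial⟩,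
        .comp (hL₁.isOfKind_vals c hΓ.left) hDA.comp_inv.1 eL₁ eL₂,
        .absorb_congr (.comp (hR₁.isOfKind_vals c hΓ.right) hbk.comp_inv.1 eR₁ eR₂)
          (hb.tyEq_absorb hBm),
        .comp (hL₁.isOfKind_names c hΓ.left) (hR₁.isOfKind_names c hΓ.right) s₁ s₂⟩
  · intro A₁ A₂ hA hAU hAB
    obtain ⟨b, hb, hab⟩ := hB.exists_headRel hAB (.arrow A₁ A₂)
    cases hab with
    | @arrow _ B₁ _ B₂ h₁ h₂ =>
      have hbU := hb.mem_of_closed hU hBU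
      have hbk := hb.isOfKind hB
      -- Domains are compared from right to left, so the call is made in the flipped context: `L₁`
      -- then lives over the right names and `R₁` over the left ones.
      obtain ⟨L₁, R₁, hL₁, hR₁, eL₁, eR₁, s₁⟩ := hs' .typ .typ B₁ A₁ (hU _ hbU _ (.arrow_l _ _))
        (hU _ hAU _ (.arrow_l _ _)) hbk.arrow_inv.1 hA.arrow_inv.1 h₁
      rw [map_left_flip] at hL₁ eL₁ s₁
      rw [map_right_flip] at hR₁ eR₁ s₁
      rw [assumptions_flip] at s₁
      obtain ⟨L₂, R₂, hL₂, hR₂, eL₂, eR₂, s₂⟩ := hs .typ .typ A₂ B₂ (hU _ hAU _ (.arrow_r _ _))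
        (hU _ hbU _ (.arrow_r _ _)) hA.arrow_inv.2 hbk.arrow_inv.2 h₂
      obtain rfl := hA.1.arrow_inv.1
      obtain rfl := hbk.1.arrow_inv.1
      exact ⟨arrow R₁ L₂, arrow L₁ R₂, ⟨hR₁.arrow hL₂, trivial⟩, ⟨hL₁.arrow hR₂, trivial⟩,
        .arrow eR₁ eL₂, .absorb_congr (.arrow eL₁ eR₂) (hb.tyEq_absorb hBm), .arrow s₁ s₂⟩
  · intro A₁ A₂ hA ih₁ ih₂ hAU hAB
    -- Each part is compared with the whole of `B`, so the right bodies collect only those heads of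
    -- `B` that were chosen as matches.
    obtain ⟨L₁, R₁, hL₁, hR₁, eL₁, eR₁, s₁⟩ := ih₁ (hU _ hAU _ (.union_l _ _))
      (approx_of_forall_head fun a ha => ⟨_, hAB, .union_l ha⟩)
    obtain ⟨L₂, R₂, hL₂, hR₂, eL₂, eR₂, s₂⟩ := ih₂ (hU _ hAU _ (.union_r _ _))
      (approx_of_forall_head fun a ha => ⟨_, hAB, .union_r ha⟩)
    exact ⟨union L₁ L₂, union R₁ R₂, ⟨hL₁.1.union hL₂.1, hL₁.2, hL₂.2⟩,
      ⟨hR₁.1.union hR₂.1, hR₁.2, hR₂.2⟩, .union eL₁ eL₂,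
      .absorb_union (hR₁.1.isOfKind_vals c hΓ.right).isMuType
        (hR₂.1.isOfKind_vals c hΓ.right).isMuType hBm eR₁ eR₂,
      .union_l (.union_r1 (hR₂.1.isOfKind_names c hΓ.right).isMuType s₁)
        (.union_r2 (hR₁.1.isOfKind_names c hΓ.right).isMuType s₂)⟩
  · intro m A hA ih hAU hAB
    obtain ⟨L, R, hL, hR, eL, eR, s⟩ := ih (hU _ hAU _ (.mu _ _))
      (approx_of_forall_head fun a ha => ⟨_, hAB, .mu ha⟩)
    exact ⟨L, R, hL, hR, .trans eL (.symm (.fold hA.isMuType)), eR, s⟩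

theorem notInCtx_assumptions {V : Var DV TV}
    (h : ∀ e ∈ Γ, e.left.name ≠ V ∧ e.right.name ≠ V) : NotInCtx V (assumptions Γ) := by
  rintro _ ⟨⟨s, t, _ | _⟩, he, rfl⟩
  exacts [(h _ he).symm, h _ he]

/-- Closing the bodies over a new pair of recursive expressions. -/
theorem solvable_of_guarded_bodies {V W : Var DV TV} (hA : IsOfKind k A) (hB : IsOfKind l B)
    (hV : V.kind = k) (hW : W.kind = l) (hVF : V ∉ F) (hWF : W ∉ F) (hVW : V ≠ W)
    (hVΓ : ∀ e ∈ Γ, e.left.name ≠ V ∧ e.right.name ≠ V)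
    (hWΓ : ∀ e ∈ Γ, e.left.name ≠ W ∧ e.right.name ≠ W) (hΓ : ValidCtx U Γ) (hBF : B.fv ⊆ F)
    {L R : PreType DV TV C} (hL : IsBody F (⟨k, A, V⟩ :: Γ.map Hyp.left) k L)
    (hLg : GuardedAt 0 L) (hR : IsBody F (⟨l, B, W⟩ :: Γ.map Hyp.right) l R)
    (hRg : GuardedAt 0 R)
    (eL : TyEq (bsub (vals c (⟨k, A, V⟩ :: Γ.map Hyp.left)) 0 L) A)
    (eR : TyEq (union (bsub (vals c (⟨l, B, W⟩ :: Γ.map Hyp.right)) 0 R) B) B)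
    (s : StrongSub (insert (V, W) (assumptions Γ))
      (bsub (names c (⟨k, A, V⟩ :: Γ.map Hyp.left)) 0 L)
      (bsub (names c (⟨l, B, W⟩ :: Γ.map Hyp.right)) 0 R)) :
    Solvable c F Γ k l A B := by
  have hL' : IsBody F (Γ.map Hyp.left) k (mu k L) := IsBody.mu (s := ⟨k, A, V⟩) hL hLg
  have hR₀ : IsBody F (⟨l, B, W⟩ :: Γ.map Hyp.right) l (union R B) := hR.union (hB.isBody hBF _)
  -- The summand `B` supplies the heads of `B` that `R` lacks. It has no dangling index, hence the
  -- body stays guarded.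
  have hR' : IsBody F (Γ.map Hyp.right) l (mu l (union R B)) :=
    IsBody.mu (s := ⟨l, B, W⟩) hR₀ ⟨hRg, hB.lc.guardedAt le_rfl⟩
  have iL : (bsub (names c (Γ.map Hyp.left)) 1 L).inst (var V) =
      bsub (names c (⟨k, A, V⟩ :: Γ.map Hyp.left)) 0 L := by
    rw [inst_bsub (lc_names c _), names_cons]
  have iR : (bsub (names c (Γ.map Hyp.right)) 1 (union R B)).inst (var W) =
      bsub (names c (⟨l, B, W⟩ :: Γ.map Hyp.right)) 0 (union R B) := by
    rw [inst_bsub (lc_names c _), names_cons]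
  have hl : ∀ X, (∀ e ∈ Γ, e.left.name ≠ X ∧ e.right.name ≠ X) → ∀ i,
      X ∉ (names c (Γ.map Hyp.left) i).fv := by
    intro X hX i h
    obtain ⟨_, hs, h⟩ := mem_fv_names h
    obtain ⟨e, he, rfl⟩ := List.mem_map.1 hs
    exact (hX e he).1 h
  have hr : ∀ X, (∀ e ∈ Γ, e.left.name ≠ X ∧ e.right.name ≠ X) → ∀ i,
      X ∉ (names c (Γ.map Hyp.right) i).fv := by
    intro X hX i h
    obtain ⟨_, hs, h⟩ := mem_fv_names h
    obtain ⟨e, he, rfl⟩ := List.mem_map.1 hs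
    exact (hX e he).2 h
  refine ⟨mu k L, mu l (union R B), hL', hR', .symm (.contr hA
    (hL'.isOfKind_vals c hΓ.left).isMuType ?_), .symm (.contr hB
    (hR'.isOfKind_vals c hΓ.right).isMuType ?_), .mu hV hW
    (hL'.isOfKind_names c hΓ.left).isMuType (hR'.isOfKind_names c hΓ.right).isMuType
    ?_ ?_ (notInCtx_assumptions hVΓ) (notInCtx_assumptions hWΓ) ?_ ?_ ?_⟩
  -- The premise of `contr`: instantiating the new binder by its intended value `A` gives back `A`
  -- up to equivalence.
  · rw [inst_bsub (lc_vals c hΓ.left)]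
    rw [vals_cons] at eL
    exact eL.symm
  · rw [inst_bsub (lc_vals c hΓ.right)]
    rw [vals_cons] at eR
    simp only [bsub, hB.lc.bsub_eq le_rfl]
    exact eR.symm
  · intro h
    rcases mem_fv_bsub h with h | ⟨i, h⟩
    exacts [hVF (hL.fv_subset h), hl V hVΓ i h]
  · intro h
    rcases mem_fv_bsub h with h | ⟨i, h⟩
    exacts [hWF (hR₀.fv_subset h), hr W hWΓ i h]
  · intro h
    rw [iL, names_cons] at h
    rcases mem_fv_bsub h with h | ⟨_ | i, h⟩
    exacts [hWF (hL.fv_subset h), hVW h.symm, hl W hWΓ i h]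
  · intro h
    rw [iR, names_cons] at h
    rcases mem_fv_bsub h with h | ⟨_ | i, h⟩
    exacts [hVF (hR₀.fv_subset h), hVW h, hr V hVΓ i h]
  · rw [iL, iR]
    refine .union_r1 ?_ s
    rw [hB.lc.bsub_eq le_rfl]
    exact hB.isMuType

/-- A pair met again is represented on both sides by the index of its own binder. The flag `co`
guarantees that the stored assumption points in the required direction. -/
theorem solvable_of_mem {e : Hyp DV TV C} (he : e ∈ Γ) (hΓ : ValidCtx U Γ) (hco : e.co = true) :
    Solvable c F Γ e.left.kind e.right.kind e.left.val e.right.val := by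
  obtain ⟨i, hi⟩ := List.mem_iff_getElem?.1 he
  have hl : (Γ.map Hyp.left)[i]? = some e.left := by simp [hi]
  have hr : (Γ.map Hyp.right)[i]? = some e.right := by simp [hi]
  refine ⟨bvar i, bvar i, ⟨.bvar (by simp [hi]), trivial, Set.empty_subset _⟩,
    ⟨.bvar (by simp [hi]), trivial, Set.empty_subset _⟩, ?_, ?_, ?_⟩
  · simp only [bsub, Nat.not_lt_zero, if_false, Nat.sub_zero, vals, hl, Option.elim]
    exact .refl (hΓ e he).1.1.1.isMuType
  · simp only [bsub, Nat.not_lt_zero, if_false, Nat.sub_zero, vals, hr, Option.elim]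
    exact .refl (hΓ e he).2.1.1.isMuType
  · simp only [bsub, Nat.not_lt_zero, if_false, Nat.sub_zero, names, hl, hr, Option.elim]
    exact .hyp ⟨e, he, by simp [Hyp.assumption, hco]⟩

/-- The recursion terminates because the keys in the context are distinct elements of a finite set,
and every new pair adds one. -/
theorem solvable_of_approx [Infinite DV] [Infinite TV] (hU : ∀ s ∈ U, ∀ t, Step s t → t ∈ U)
    (hUfin : U.Finite) (hF : ∀ t ∈ U, t.fv ⊆ F) (hFfin : F.Finite) (c : C)
    (hΓ : ValidCtx U Γ) (hnd : (Γ.map Hyp.key).Nodup)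
    (hAU : A ∈ U) (hBU : B ∈ U) (hA : IsOfKind k A) (hB : IsOfKind l B)
    (hAB : ∀ n, Approx Eq n A B) : Solvable c F Γ k l A B := by
  -- Keys record sorts because a bound variable of sort `.typ` cannot stand for a datatype, and
  -- directions because of the flips.
  let K : Set (Bool × (Kind × PreType DV TV C) × (Kind × PreType DV TV C)) :=
    Set.univ ×ˢ (({.data, .typ} ×ˢ U) ×ˢ ({.data, .typ} ×ˢ U))
  have hkind : ∀ k : Kind, k ∈ ({.data, .typ} : Set Kind) := by rintro (_ | _) <;> simp
  have hkfin : ({.data, .typ} : Set Kind).Finite := by simp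
  have hK : K.Finite := Set.finite_univ.prod ((hkfin.prod hUfin).prod (hkfin.prod hUfin))
  -- `N` counts the entries that may still be added; at `N = 0` the context would have more distinct
  -- keys than `K` has elements.
  obtain ⟨N, hN⟩ : ∃ N, K.ncard < Γ.length + N := ⟨K.ncard + 1, by omega⟩
  induction N generalizing Γ k l A B with
  | zero =>
    classical
    have h : ((Γ.map Hyp.key).toFinset : Set _) ⊆ K := by
      intro p hp
      obtain ⟨e, he, rfl⟩ := List.mem_map.1 (List.mem_toFinset.1 hp)
      exact ⟨trivial, ⟨hkind _, (hΓ e he).1.2⟩, hkind _, (hΓ e he).2.2⟩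
    have := Set.ncard_le_ncard h hK
    rw [Set.ncard_coe_finset, List.toFinset_card_of_nodup hnd, List.length_map] at this
    omega
  | succ N ih =>
    by_cases hmem : (true, (k, A), (l, B)) ∈ Γ.map Hyp.key
    · obtain ⟨e, he, hek⟩ := List.mem_map.1 hmem
      simp only [Hyp.key, Prod.mk.injEq] at hek
      obtain ⟨hco, ⟨rfl, rfl⟩, rfl, rfl⟩ := hek
      exact solvable_of_mem he hΓ hco
    have hG : {X | ∃ e ∈ Γ, e.left.name = X ∨ e.right.name = X}.Finite := by
      refine ((Γ.map fun e => e.left.name) ++ Γ.map fun e => e.right.name).finite_toSet.subset ?_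
      rintro X ⟨e, he, h⟩
      exact List.mem_append.2 (h.imp (fun h => List.mem_map.2 ⟨e, he, h⟩)
        fun h => List.mem_map.2 ⟨e, he, h⟩)
    obtain ⟨V, hVk, hV⟩ := exists_fresh (hFfin.union hG) k
    obtain ⟨W, hWk, hW⟩ := exists_fresh ((hFfin.union hG).union (Set.finite_singleton V)) l
    have hΓ' : ValidCtx U (⟨⟨k, A, V⟩, ⟨l, B, W⟩, true⟩ :: Γ) := by
      intro e he
      rcases List.mem_cons.1 he with rfl | he
      exacts [⟨⟨⟨hA, hVk⟩, hAU⟩, ⟨hB, hWk⟩, hBU⟩, hΓ e he]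
    have hnd' : ((⟨⟨k, A, V⟩, ⟨l, B, W⟩, true⟩ :: Γ).map Hyp.key).Nodup :=
      List.nodup_cons.2 ⟨hmem, hnd⟩
    obtain ⟨L, R, hL, hR, eL, eR, s⟩ := exists_guarded_bodies hU hF hΓ'
      (fun k l A B hAU hBU hA hB hAB => ih hΓ' hnd' hAU hBU hA hB hAB
        (by simp only [List.length_cons]; omega))
      (fun k l A B hAU hBU hA hB hAB => ih hΓ'.flip (nodup_key_flip hnd') hAU hBU hA hB hAB
        (by simp only [List.length_map, List.length_cons]; omega))
      hBU hB hAU hA hAB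
    rw [assumptions_cons] at s
    refine solvable_of_guarded_bodies hA hB hVk hWk (fun h => hV (.inl h))
      (fun h => hW (.inl (.inl h))) (fun h => hW (.inr h.symm)) (fun e he => ?_)
      (fun e he => ?_) hΓ (hF _ hBU) hL.1 hL.2 hR.1 hR.2 eL eR s
    · exact ⟨fun h => hV (.inr ⟨e, he, .inl h⟩), fun h => hV (.inr ⟨e, he, .inr h⟩)⟩
    · exact ⟨fun h => hW (.inl (.inr ⟨e, he, .inl h⟩)), fun h => hW (.inl (.inr ⟨e, he, .inr h⟩))⟩

end Completeness

theorem CoSub.strongSub [Infinite DV] [Infinite TV] [Nonempty C] {A B : PreType DV TV C}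
    (hA : IsMuType A) (hB : IsMuType B) (h : CoSub A B) : StrongSub ∅ A B := by
  obtain ⟨c⟩ := ‹Nonempty C›
  obtain ⟨U, hUfin, hAU, hU⟩ := hA.lc.exists_finite_closed
  obtain ⟨U', hUfin', hBU, hU'⟩ := hB.lc.exists_finite_closed
  obtain ⟨L, R, hL, hR, eL, eR, s⟩ := solvable_of_approx (U := U ∪ U')
    (F := ⋃ t ∈ U ∪ U', t.fv) (Γ := [])
    (fun s hs t hst => hs.imp (hU s · t hst) (hU' s · t hst)) (hUfin.union hUfin')
    (fun t ht => Set.subset_biUnion_of_mem (u := fv) ht)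
    ((hUfin.union hUfin').biUnion fun t _ => t.finite_fv) c nofun List.nodup_nil
    (.inl hAU) (.inr hBU) hA hB h.approx
  -- Over the empty context `L` and `R` are closed, so the environments of values and of names both
  -- act trivially and `A ≃ L ⪯ R ≃ B`.
  have hL' : LC 0 L := hL.sorted.lc
  have hR' : LC 0 R := hR.sorted.lc
  rw [hL'.bsub_eq le_rfl] at eL s
  rw [hR'.bsub_eq le_rfl] at eR s
  have hS : assumptions ([] : List (Hyp DV TV C)) = ∅ := by simp [assumptions]
  rw [hS] at s
  exact .trans (.eq eL.symm) (.trans s (.eq eR))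

end PreType

end MuTypes

theorem mainTheorem1 {DV TV C : Type*} [Countable DV] [Infinite DV] [Countable TV] [Infinite TV]
    [Countable C] [Infinite C] (A B : MuTypes.PreType DV TV C)
    (hA : A.IsMuType) (hB : B.IsMuType) :
    MuTypes.PreType.CoSub A B ↔ MuTypes.PreType.StrongSub ∅ A B :=
  ⟨fun h => h.strongSub hA hB, fun h => h.coSub hA hB⟩
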